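/- Write $e_t(x)=e^{2\pi i t x}$. Let $R=3$, $B=\{0,2\}$, $L=\{0,3/4\}$, $\tau_b(x)=\frac{x+b}{3}$ for $b\in B$, and let $X_B=\{\sum_{k\ge1}3^{-k}b_k : b_k\in B\}$ be the attractor of the iterated function system $(\tau_b)_{b\in B}$. Let $\mu_B$ be its invariant measure, i.e. the Borel probability measure on $\mathbb R$ with $\int f\,d\mu_B=\frac12\sum_{b\in B}\int f\circ\tau_b\,d\mu_B$ for all continuous compactly supported $f$. Let $m_B(x)=\frac12\sum_{b\in B}e^{2\pi i b x}$. An *extreme cycle* for $(B,L)$ is a set $\{c_0,\dots,c_{p-1}\}\subset\mathbb R$, $p\ge1$, such that for some $l_0,\dots,l_{p-1}\in L$ we have $c_{i+1}=\frac{c_i+l_i}{3}$ for $0\le i<p$, with $c_p=c_0$, and $|m_B(c_i)|=1$ for all $i$; its elements are called *extreme cycle points*. Then: 1. $X_B$ is the middle-third Cantor set, and $L$ is a spectrum for $\frac13B$, i.e. $|L|=|B|=2$ and the matrix $\frac1{\sqrt2}\big[e^{2\pi i a l}\big]_{a\in\frac13B,\;l\in L}$ is unitary. 2. The only extreme cycle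 for $(B,L)$ is $\{0\}$, and the only extreme cycle point is $0$. 3. The system has no overlap: $\mu_B(\tau_0(X_B)\cap\tau_2(X_B))=0$. The map $r$ given $\mu_B$-almost everywhere by $r(x)=3x-b$ for $x\in\tau_b(X_B)$ preserves $\mu_B$, so that $S_lf=e_l\cdot(f\circ r)$, $l\in L$, are isometries of $L^2(\mu_B)$. With $S_w=S_{l_1}S_{l_2}\cdots S_{l_n}$ for a word $w=l_1\cdots l_n$ (and $S_\emptyset=I$), the set $\{S_w1 : w\in\{0,3/4\}^*\}$, where $\{0,3/4\}^*$ is the set of all finite words with digits in $L$, including the empty one, and repeated vectors are counted once, is an orthonormal basis of $L^2(\mu_B)$. 4. The functions $S_w1$ are piecewise exponential with phase factors $\pm1$: for every $n\ge0$ and $l_1,\dots,l_n\in L$, $\mu_B$-almost every $x$ lies in $\tau_{b_1}\cdots\tau_{b_n}(X_B)$ for some $b_1,\dots,b_n\in B$, and whenever it does, $$S_{l_1\cdots l_n}1(x)=e^{2\pi i\alpha(b,l)}\,e_{l_1+3l_2+\cdots+3^{n-1}l_n}(x),\qquad \alpha(b,l)=-\sum_{k=2}^{n}\Big(\sum_{j=1}^{k-1}3^{k-1-j}b_j\Big)l_k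 ;$$ moreover $e^{2\pi i\alpha(b,l)}\in\{1,-1\}$ for all $b_1,\dots,b_n\in B$. -/

import Mathlib

open MeasureTheory

noncomputable section

namespace PiecewiseExp

/-- The exponential function `e_t(x) = exp(2 π i t x)`. -/
def expFun (t x : ℝ) : ℂ := Complex.exp (2 * Real.pi * Complex.I * t * x)

/-- `Λ` is a spectrum for the finite set `A`: `|Λ| = |A| = N` and the matrix
`N^{-1/2} [exp(2 π i a t)]`, `a ∈ A`, `t ∈ Λ`, is unitary. -/
def IsSpectrum (A Λ : Finset ℝ) : Prop :=
  Λ.card = A.card ∧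
    let M : Matrix A Λ ℂ := fun a t => ((Real.sqrt A.card : ℝ) : ℂ)⁻¹ * expFun t a
    M * M.conjTranspose = 1 ∧ M.conjTranspose * M = 1

/-- The maps `τ_b(x) = R⁻¹ (x + b)` of the iterated function system given by `R`, `b ∈ B`. -/
def tau (R b x : ℝ) : ℝ := R⁻¹ * (x + b)

/-- The attractor `X_B` of the iterated function system `(τ_b)_{b ∈ B}`: the set of all sums
`∑_{k ≥ 1} R^{-k} b_k` with digits `b_k ∈ B`. -/
def attractor (R : ℝ) (B : Finset ℝ) : Set ℝ :=
  {x | ∃ b : ℕ → ℝ, (∀ k, b k ∈ B) ∧ HasSum (fun k => (R ^ (k + 1))⁻¹ * b k) x}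

/-- The probability measure `μ` is the invariant measure of the iterated function system
`(τ_b)_{b ∈ B}`: it satisfies `∫ f dμ = N⁻¹ ∑_b ∫ f ∘ τ_b dμ` for all continuous functions `f` with
compact support. -/
def IsInvariantMeasure (R : ℝ) (B : Finset ℝ) (μ : Measure ℝ) [IsProbabilityMeasure μ] : Prop :=
  ∀ f : ℝ → ℝ, Continuous f → HasCompactSupport f →
    ∫ x, f x ∂μ = (B.card : ℝ)⁻¹ * ∑ b ∈ B, ∫ x, f (tau R b x) ∂μ

/-- An invariant measure exists: the law of `∑_{k ≥ 1} R^{-k} b_k` for independent digits `b_k`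
uniformly distributed in `B`. -/
lemma exists_isInvariantMeasure (R : ℝ) (hR : 1 < R) (B : Finset ℝ) (hB : B.Nonempty) :
    ∃ (μ : Measure ℝ) (_ : IsProbabilityMeasure μ), IsInvariantMeasure R B μ := by
  classical
  have : Nonempty B := hB.to_subtype
  let P : Measure B := ProbabilityTheory.uniformOn Set.univ
  have : IsProbabilityMeasure P := ProbabilityTheory.isProbabilityMeasure_uniformOn Set.finite_univ Set.univ_nonempty
  let ν : Measure (ℕ → B) := Measure.infinitePi fun _ => P
  let T : B × (ℕ → B) → (ℕ → B) := fun p n => Nat.casesOn n p.1 p.2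
  have hT : Measurable T := by
    refine measurable_pi_lambda _ fun n => ?_
    cases n with
    | zero => exact measurable_fst
    | succ n => exact (measurable_pi_apply n).comp measurable_snd
  have hTν : Measure.map T (P.prod ν) = ν := by
    refine Measure.eq_infinitePi _ fun s t ht => ?_
    rw [Measure.map_apply hT (MeasurableSet.pi s.countable_toSet fun i _ => ht i)]
    let s' : Finset ℕ := s.preimage Nat.succ (Nat.succ_injective.injOn)
    have hset : T ⁻¹' (Set.pi s t) =
        (if 0 ∈ s then t 0 else Set.univ) ×ˢ (Set.pi s' fun i => t (i + 1)) := by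
      ext ⟨b, ω⟩
      simp only [Set.mem_preimage, Set.mem_pi, Set.mem_prod, Finset.mem_coe, s', Finset.mem_preimage]
      constructor
      · intro h
        refine ⟨?_, fun i hi => h (i+1) hi⟩
        split_ifs with h0
        · exact h 0 h0
        · trivial
      · rintro ⟨h1, h2⟩ i hi
        cases i with
        | zero => rw [if_pos hi] at h1; exact h1
        | succ i => exact h2 i hi
    rw [hset, Measure.prod_prod, Measure.infinitePi_pi _ (fun i _ => ht _)]
    have hprod : ∏ i ∈ s', P (t (i+1)) = ∏ i ∈ s.erase 0, P (t i) := by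
      refine Finset.prod_bij (fun i _ => i + 1) ?_ ?_ ?_ ?_
      · intro i hi; simpa [s'] using hi
      · intro i _ j _ h; simpa using h
      · intro i hi
        obtain ⟨h0, h1⟩ := Finset.mem_erase.1 hi
        obtain ⟨j, rfl⟩ := Nat.exists_eq_succ_of_ne_zero h0
        exact ⟨j, by simpa [s'] using h1, rfl⟩
      · intros; rfl
    rw [hprod]
    split_ifs with h0
    · rw [Finset.mul_prod_erase s (fun i => P (t i)) h0]
    · rw [Finset.erase_eq_of_notMem h0]; simp
  obtain ⟨C, hC⟩ : ∃ C : ℝ, ∀ b ∈ B, |b| ≤ C := by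
    obtain ⟨C, hC⟩ := (B.image fun b => |b|).exists_le
    exact ⟨C, fun b hb => hC _ (Finset.mem_image_of_mem _ hb)⟩
  have hR0 : 0 < R := by linarith
  have hsum : ∀ ω : ℕ → B, Summable fun k => (R ^ (k + 1))⁻¹ * (ω k : ℝ) := by
    intro ω
    have hg : Summable fun k : ℕ => (R⁻¹) ^ (k+1) * C :=
      (((summable_nat_add_iff 1).2 (summable_geometric_of_lt_one (by positivity) (inv_lt_one_of_one_lt₀ hR)))).mul_right C
    refine Summable.of_norm_bounded hg fun k => ?_
    rw [norm_mul, inv_pow, Real.norm_of_nonneg (by positivity)]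
    exact mul_le_mul_of_nonneg_left (hC _ (ω k).2) (by positivity)
  let g : (ℕ → B) → ℝ := fun ω => ∑' k, (R ^ (k + 1))⁻¹ * (ω k : ℝ)
  have hg : Measurable g := by
    refine measurable_of_tendsto_metrizable (f := fun n ω => ∑ k ∈ Finset.range n, (R ^ (k + 1))⁻¹ * (ω k : ℝ)) ?_ ?_
    · intro n
      refine Finset.measurable_sum _ fun k _ => ?_
      exact (measurable_subtype_coe.comp (measurable_pi_apply k)).const_mul _
    · exact tendsto_pi_nhds.2 fun ω => (hsum ω).hasSum.tendsto_sum_nat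
  have hgT : ∀ b ω, g (T (b, ω)) = tau R b (g ω) := by
    intro b ω
    change ∑' k, _ = _
    rw [(hsum _).tsum_eq_zero_add]
    simp only [T, tau, g]
    rw [mul_add, add_comm, ← tsum_mul_left]
    congr 1
    · refine tsum_congr fun k => ?_
      rw [pow_succ' R (k+1), mul_inv, mul_assoc]
    · simp
  have : IsProbabilityMeasure (ν.map g) := Measure.isProbabilityMeasure_map hg.aemeasurable
  refine ⟨ν.map g, inferInstance, fun f hf hfc => ?_⟩
  have hfm : ∀ h : ℝ → ℝ, Continuous h → ∫ x, h x ∂(ν.map g) = ∫ ω, h (g ω) ∂ν := fun h hh =>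
    integral_map hg.aemeasurable hh.aestronglyMeasurable
  obtain ⟨K, hK⟩ := hf.bounded_above_of_compact_support hfc
  rw [hfm f hf]
  have e1 : ∫ ω, f (g ω) ∂ν = ∫ p, f (g (T p)) ∂(P.prod ν) := by
    conv_lhs => rw [← hTν]
    exact integral_map hT.aemeasurable (hf.measurable.comp hg).aestronglyMeasurable
  have e2 : Integrable (fun p => f (g (T p))) (P.prod ν) := Integrable.of_bound
    (hf.measurable.comp (hg.comp hT)).aestronglyMeasurable K
    (Filter.Eventually.of_forall fun _ => hK _)
  rw [e1, integral_prod _ e2]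
  simp only [hgT]
  rw [integral_fintype (Integrable.of_finite)]
  have hP : ∀ b : B, P.real {b} = (B.card : ℝ)⁻¹ := by
    intro b
    simp [P, Measure.real, ProbabilityTheory.uniformOn_univ]
  simp only [hP, smul_eq_mul]
  rw [← Finset.mul_sum, ← Finset.sum_coe_sort B]
  congr 1
  refine Finset.sum_congr rfl fun b _ => ?_
  rw [hfm (fun x => f (tau R b x)) (by unfold tau; fun_prop)]

/-- The iterated function system has no overlap with respect to `μ`. -/
def NoOverlap (R : ℝ) (B : Finset ℝ) (μ : Measure ℝ) : Prop :=
  ∀ b ∈ B, ∀ b' ∈ B, b ≠ b' →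
    μ ((tau R b '' attractor R B) ∩ (tau R b' '' attractor R B)) = 0

open Classical in
/-- The map `r` with `r(x) = τ_b⁻¹(x) = R x - b` for `x ∈ τ_b(X_B)`. The value `0` outside the
attractor plays no role, and the choice of `b` plays none off the overlaps. -/
def shiftMap (R : ℝ) (B : Finset ℝ) (x : ℝ) : ℝ :=
  if h : ∃ b, b ∈ B ∧ x ∈ tau R b '' attractor R B then R * x - h.choose else 0

/-- The function `m_B(x) = N⁻¹ ∑_{b ∈ B} exp(2 π i b x)`. -/
def maskFun (B : Finset ℝ) (x : ℝ) : ℂ := (B.card : ℂ)⁻¹ * ∑ b ∈ B, expFun b x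

/-- `c 0, …, c (p - 1)` runs through an extreme cycle for `(B, L)`: each point is mapped to the
next one (and the last one to `c 0`) by some `t ↦ (t + l) / R` with `l ∈ L`, and `|m_B| = 1` at
each of them. -/
def IsExtremeCycleSeq (R : ℝ) (B L : Finset ℝ) (p : ℕ) (c : ℕ → ℝ) : Prop :=
  0 < p ∧ c p = c 0 ∧
    ∀ i < p, (∃ l ∈ L, c (i + 1) = (c i + l) / R) ∧ ‖maskFun B (c i)‖ = 1

/-- `c` is an extreme cycle point for `(B, L)`. -/
def IsExtremeCyclePoint (R : ℝ) (B L : Finset ℝ) (c : ℝ) : Prop :=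
  ∃ (p : ℕ) (s : ℕ → ℝ), IsExtremeCycleSeq R B L p s ∧ s 0 = c

/-- The set `C` is an extreme cycle for `(B, L)`. -/
def IsExtremeCycle (R : ℝ) (B L : Finset ℝ) (C : Set ℝ) : Prop :=
  ∃ (p : ℕ) (s : ℕ → ℝ), IsExtremeCycleSeq R B L p s ∧ C = s '' {i | i < p}

lemma norm_expFun (t x : ℝ) : ‖expFun t x‖ = 1 := by
  have h : (2 * Real.pi * Complex.I * t * x : ℂ) = ((2 * Real.pi * t * x : ℝ) : ℂ) * Complex.I := by
    push_cast; ring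
  rw [expFun, h, Complex.norm_exp_ofReal_mul_I]

lemma continuous_expFun (t : ℝ) : Continuous (expFun t) := by
  unfold expFun; fun_prop

lemma eLpNorm_expFun_mul (μ : Measure ℝ) (t : ℝ) (f : ℝ → ℂ) :
    eLpNorm (fun x => expFun t x * f x) 2 μ = eLpNorm f 2 μ :=
  eLpNorm_congr_norm_ae (Filter.Eventually.of_forall fun x => by simp [norm_expFun])

lemma memLp_cuntz {μ : Measure ℝ} {r : ℝ → ℝ} (hr : MeasurePreserving r μ μ) (l : ℝ)
    (f : Lp ℂ 2 μ) : MemLp (fun x => expFun l x * f (r x)) 2 μ := by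
  have h := (Lp.memLp f).comp_measurePreserving hr
  refine ⟨(continuous_expFun l).aestronglyMeasurable.mul h.1, ?_⟩
  have := eLpNorm_expFun_mul μ l (f ∘ r)
  simp only [Function.comp_apply] at this
  rw [this]
  exact h.2

/-- The isometry `S_l f = e_l · (f ∘ r)` of `L²(μ)`. -/
def cuntzOp {μ : Measure ℝ} {r : ℝ → ℝ} (hr : MeasurePreserving r μ μ) (l : ℝ) :
    Lp ℂ 2 μ →ₗᵢ[ℂ] Lp ℂ 2 μ where
  toFun f := (memLp_cuntz hr l f).toLp (fun x => expFun l x * f (r x))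
  map_add' f g := by
    rw [← MemLp.toLp_add]
    refine MemLp.toLp_congr _ _ ?_
    filter_upwards [hr.quasiMeasurePreserving.ae (Lp.coeFn_add f g)] with x hx
    simp only [Pi.add_apply] at hx ⊢
    rw [hx]; ring
  map_smul' c f := by
    rw [RingHom.id_apply, ← MemLp.toLp_const_smul]
    refine MemLp.toLp_congr _ _ ?_
    filter_upwards [hr.quasiMeasurePreserving.ae (Lp.coeFn_smul c f)] with x hx
    simp only [Pi.smul_apply, smul_eq_mul] at hx ⊢
    rw [hx]; ring
  norm_map' f := by
    change ‖(memLp_cuntz hr l f).toLp (fun x => expFun l x * f (r x))‖ = ‖f‖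
    rw [Lp.norm_toLp, eLpNorm_expFun_mul μ l (fun x => f (r x)), Lp.norm_def]
    congr 1
    exact eLpNorm_comp_measurePreserving (Lp.aestronglyMeasurable f) hr

/-- `S_w f = S_{l_1} S_{l_2} ⋯ S_{l_n} f` for the word `w = l_1 l_2 ⋯ l_n`. -/
def cuntzWord {μ : Measure ℝ} {r : ℝ → ℝ} (hr : MeasurePreserving r μ μ) {L : Finset ℝ}
    (w : List L) (f : Lp ℂ 2 μ) : Lp ℂ 2 μ :=
  w.foldr (fun l g => cuntzOp hr l g) f

/-- The cylinder `τ_{b_1} τ_{b_2} ⋯ τ_{b_n} (X_B)`. -/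
def ifsCylinder (R : ℝ) (B : Finset ℝ) {n : ℕ} (b : Fin n → B) : Set ℝ :=
  (fun x => (List.ofFn b).foldr (fun d y => tau R d y) x) '' attractor R B

/-- The phase `α(b, l) = -[b_1 l_2 + (R b_1 + b_2) l_3 + ⋯ + (R^{n-2} b_1 + ⋯ + b_{n-1}) l_n]`
(with indices starting at `0` instead of `1`). -/
def phase (R : ℝ) {n : ℕ} (b l : Fin n → ℝ) : ℝ :=
  -∑ k : Fin n, (∑ j ∈ Finset.univ.filter (fun j : Fin n => j < k),
    R ^ ((k : ℕ) - 1 - (j : ℕ)) * b j) * l k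

/-- The frequency `l_1 + R l_2 + ⋯ + R^{n-1} l_n`. -/
def freq (R : ℝ) {n : ℕ} (l : Fin n → ℝ) : ℝ := ∑ k : Fin n, R ^ (k : ℕ) * l k

/-- The digits of the iterated function system of the middle-third Cantor set. -/
def cantorB : Finset ℝ := {0, 2}

/-- The set `{0, 3/4}`. -/
def cantorL : Finset ℝ := {0, 3 / 4}

end PiecewiseExp

end

open PiecewiseExp

/-!
The operators `S_l`, `l ∈ L`, have orthogonal ranges, because `m_B` vanishes at `(l - l') / R`, and
`S_0 1 = 1`. Hence two different vectors among the `S_w 1` are orthogonal. For completeness, the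
spectral condition gives
`e_t = ∑_{l ∈ L} m_B((t - l) / R) S_l e_{(t - l) / R}`,
and the projection `Q` onto the orthogonal complement of the `S_w 1` commutes with every `S_l`.
Therefore `h(t) = ‖Q e_{-t}‖²` satisfies `h(t) = ∑_{l ∈ L} |m_B(τ_l t)|² h(τ_l t)` with weights of
sum `1`. If `h` is maximal over the attractor `X_L` at `s`, then, since `m_B(t / R) ≠ 0` for
`t ∈ X_L`, it is also maximal at `s / R`, `s / R²`, …, hence at `0`, where `h = 0`. As the maps
`τ_l` attract every point to `X_L`, the bound `h ≤ 0` spreads to the real line, and exponentials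
are total in `L²(μ)`. The same non-vanishing of `m_B`, with weights of sum `1`, rules out a step
with `l ≠ 0` in an extreme cycle.
-/

namespace PiecewiseExp

open scoped ENNReal NNReal InnerProductSpace Topology

@[simp] lemma expFun_zero_left (x : ℝ) : expFun 0 x = 1 := by simp [expFun]

@[simp] lemma expFun_zero_right (t : ℝ) : expFun t 0 = 1 := by simp [expFun]

lemma expFun_add_left (s t x : ℝ) : expFun (s + t) x = expFun s x * expFun t x := by
  simp only [expFun, ← Complex.exp_add, Complex.ofReal_add]
  ring_nf

lemma expFun_add_right (t x y : ℝ) : expFun t (x + y) = expFun t x * expFun t y := by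
  simp only [expFun, ← Complex.exp_add, Complex.ofReal_add]
  ring_nf

lemma expFun_congr {s t x y : ℝ} (h : s * x = t * y) : expFun s x = expFun t y := by
  have h' : (s : ℂ) * x = t * y := mod_cast h
  simp only [expFun, mul_assoc, h']

lemma star_expFun (t x : ℝ) : star (expFun t x) = expFun (-t) x := by
  simp [expFun, ← Complex.exp_conj, map_ofNat]

lemma expFun_re (t x : ℝ) : (expFun t x).re = Real.cos (2 * Real.pi * t * x) := by
  rw [← Complex.exp_ofReal_mul_I_re, expFun]
  push_cast
  ring_nf

lemma expFun_eq_neg_one {t x : ℝ} (h : |t * x| = 1 / 2) : expFun t x = -1 := by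
  have hpos {s : ℝ} (hs : s = 1 / 2) : expFun s 1 = -1 := by
    rw [hs, expFun, ← Complex.exp_pi_mul_I]
    push_cast
    ring_nf
  obtain h | h := (abs_eq (by norm_num)).1 h
  · rw [expFun_congr (mul_one (t * x)).symm, hpos h]
  · rw [← star_star (expFun t x), star_expFun, expFun_congr (by ring : -t * x = -(t * x) * 1),
      hpos (neg_eq_iff_eq_neg.2 h), star_neg, star_one]

lemma expFun_eq_one_or_neg_one {t : ℝ} (ht : t ∈ AddSubgroup.zmultiples (1 / 2 : ℝ)) :
    expFun t 1 ∈ ({1, -1} : Set ℂ) := by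
  obtain ⟨n, rfl⟩ := AddSubgroup.mem_zmultiples_iff.1 ht
  have h : expFun (n • (1 / 2)) 1 = (-1) ^ n := by
    rw [← Complex.exp_pi_mul_I, ← Complex.exp_int_mul, expFun, zsmul_eq_mul]
    push_cast
    ring_nf
  rw [h]
  exact (Int.even_or_odd n).imp Even.neg_one_zpow Odd.neg_one_zpow

/-- The matrix `[exp(2 π i a t)]`, `a ∈ A`, `t ∈ Λ`, without the normalization used in
`IsSpectrum`. -/
noncomputable def expMatrix (A Λ : Finset ℝ) : Matrix A Λ ℂ := Matrix.of fun a t => expFun t a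

lemma expMatrix_mul_conjTranspose_apply (A Λ : Finset ℝ) (a a' : A) :
    (expMatrix A Λ * (expMatrix A Λ).conjTranspose) a a' = ∑ t ∈ Λ, expFun t (a - a') := by
  rw [← Finset.sum_coe_sort, Matrix.mul_apply]
  refine Finset.sum_congr rfl fun t _ => ?_
  rw [Matrix.conjTranspose_apply, sub_eq_add_neg, expFun_add_right]
  simp only [expMatrix, Matrix.of_apply, star_expFun]
  rw [expFun_congr (by ring : -(t : ℝ) * a' = t * -a')]

lemma conjTranspose_expMatrix_mul_apply (A Λ : Finset ℝ) (t t' : Λ) :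
    ((expMatrix A Λ).conjTranspose * expMatrix A Λ) t t' = ∑ a ∈ A, expFun (t' - t) a := by
  rw [← Finset.sum_coe_sort, Matrix.mul_apply]
  refine Finset.sum_congr rfl fun a _ => ?_
  rw [Matrix.conjTranspose_apply, sub_eq_neg_add, expFun_add_left]
  simp only [expMatrix, Matrix.of_apply, star_expFun]

lemma isSpectrum_iff_expMatrix {A Λ : Finset ℝ} (hA : A.Nonempty) :
    IsSpectrum A Λ ↔ Λ.card = A.card ∧
      expMatrix A Λ * (expMatrix A Λ).conjTranspose = (A.card : ℂ) • 1 ∧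
      (expMatrix A Λ).conjTranspose * expMatrix A Λ = (A.card : ℂ) • 1 := by
  have hN : (A.card : ℂ) ≠ 0 := mod_cast hA.card_ne_zero
  set s : ℂ := ((Real.sqrt A.card : ℝ) : ℂ)⁻¹ with hs
  have hss : s * s = (A.card : ℂ)⁻¹ := by
    rw [hs, ← mul_inv, ← Complex.ofReal_mul, Real.mul_self_sqrt (Nat.cast_nonneg _),
      Complex.ofReal_natCast]
  have hstar : star s = s := by rw [hs, star_inv₀, Complex.star_def, Complex.conj_ofReal]
  have hM : (fun a t => s * expFun t a : Matrix A Λ ℂ) = s • expMatrix A Λ := rfl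
  simp only [IsSpectrum, ← hs, hM, Matrix.conjTranspose_smul, hstar, Matrix.smul_mul,
    Matrix.mul_smul, smul_smul, hss, inv_smul_eq_iff₀ hN]

lemma isSpectrum_iff {A Λ : Finset ℝ} (hA : A.Nonempty) :
    IsSpectrum A Λ ↔ Λ.card = A.card ∧
      ∀ a ∈ A, ∀ a' ∈ A, a ≠ a' → ∑ t ∈ Λ, expFun t (a - a') = 0 := by
  have hN : (A.card : ℂ) ≠ 0 := mod_cast hA.card_ne_zero
  rw [isSpectrum_iff_expMatrix hA]
  refine and_congr_right fun hcard => ⟨fun h a ha a' ha' hne => ?_, fun h => ?_⟩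
  · have := congrFun₂ h.1 ⟨a, ha⟩ ⟨a', ha'⟩
    simpa [expMatrix_mul_conjTranspose_apply, Matrix.one_apply, hne] using this
  have hrow : expMatrix A Λ * (expMatrix A Λ).conjTranspose = (A.card : ℂ) • 1 := by
    ext ⟨a, ha⟩ ⟨a', ha'⟩
    rw [expMatrix_mul_conjTranspose_apply, Matrix.smul_apply, Matrix.one_apply]
    split_ifs with heq
    · obtain rfl : a = a' := congrArg Subtype.val heq
      simp [hcard]
    · simpa using h a ha a' ha' fun h => heq (Subtype.ext h)
  refine ⟨hrow, ?_⟩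
  rw [← inv_smul_eq_iff₀ hN] at hrow ⊢
  rw [← Matrix.smul_mul] at hrow
  rw [← Matrix.mul_smul]
  exact (Matrix.mul_eq_one_comm_of_card_eq _ _ _ (by simp [hcard])).1 hrow

lemma IsSpectrum.sum_expFun_sub_right {A Λ : Finset ℝ} (h : IsSpectrum A Λ) {a a' : ℝ} (ha : a ∈ A)
    (ha' : a' ∈ A) : ∑ t ∈ Λ, expFun t (a - a') = if a = a' then (A.card : ℂ) else 0 := by
  split_ifs with heq
  · simp [heq, h.1]
  · exact ((isSpectrum_iff ⟨a, ha⟩).1 h).2 a ha a' ha' heq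

lemma IsSpectrum.sum_expFun_sub_left {A Λ : Finset ℝ} (h : IsSpectrum A Λ) {t t' : ℝ} (ht : t ∈ Λ)
    (ht' : t' ∈ Λ) (hne : t ≠ t') : ∑ a ∈ A, expFun (t - t') a = 0 := by
  have hA : A.Nonempty := Finset.card_pos.1 (h.1 ▸ Finset.card_pos.2 ⟨t, ht⟩)
  have := congrFun₂ ((isSpectrum_iff_expMatrix hA).1 h).2.2 ⟨t', ht'⟩ ⟨t, ht⟩
  simpa [conjTranspose_expMatrix_mul_apply, Matrix.one_apply, hne.symm] using this

lemma maskFun_zero {B : Finset ℝ} (hB : B.Nonempty) : maskFun B 0 = 1 := by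
  simp [maskFun, expFun_zero_right, hB.card_ne_zero]

lemma star_maskFun (B : Finset ℝ) (x : ℝ) : star (maskFun B x) = maskFun B (-x) := by
  simp only [maskFun, star_mul', star_inv₀, star_natCast, star_sum, star_expFun]
  congr 1
  exact Finset.sum_congr rfl fun b _ => expFun_congr (by ring)

lemma norm_maskFun_neg (B : Finset ℝ) (x : ℝ) : ‖maskFun B (-x)‖ = ‖maskFun B x‖ := by
  rw [← star_maskFun, norm_star]

section Spectrum

variable {R : ℝ} {B L : Finset ℝ}

lemma sum_image_inv_mul {M : Type*} [AddCommMonoid M] (hR : R ≠ 0) (f : ℝ → M) :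
    ∑ a ∈ B.image (fun b => R⁻¹ * b), f a = ∑ b ∈ B, f (R⁻¹ * b) :=
  Finset.sum_image (mul_right_injective₀ (inv_ne_zero hR)).injOn

lemma card_image_inv_mul (hR : R ≠ 0) : (B.image (fun b => R⁻¹ * b)).card = B.card :=
  Finset.card_image_of_injective _ (mul_right_injective₀ (inv_ne_zero hR))

lemma maskFun_sub_div_eq_zero (hR : R ≠ 0) (h : IsSpectrum (B.image fun b => R⁻¹ * b) L)
    {l l' : ℝ} (hl : l ∈ L) (hl' : l' ∈ L) (hne : l ≠ l') : maskFun B ((l - l') / R) = 0 := by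
  have := h.sum_expFun_sub_left hl hl' hne
  rw [sum_image_inv_mul hR] at this
  rw [maskFun, ← mul_zero (B.card : ℂ)⁻¹, ← this]
  congr 1
  exact Finset.sum_congr rfl fun b _ => expFun_congr (by ring)

lemma sum_maskFun_mul_expFun (hR : R ≠ 0) (h : IsSpectrum (B.image fun b => R⁻¹ * b) L)
    (t : ℝ) {b : ℝ} (hb : b ∈ B) :
    ∑ l ∈ L, maskFun B ((t - l) / R) * expFun l (R⁻¹ * b) = expFun t (R⁻¹ * b) := by
  have hN : (B.card : ℂ) ≠ 0 := mod_cast Finset.card_ne_zero_of_mem hb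
  have horth (b' : ℝ) (hb' : b' ∈ B) :
      ∑ l ∈ L, expFun l (R⁻¹ * b - R⁻¹ * b') = if b = b' then (B.card : ℂ) else 0 := by
    have := h.sum_expFun_sub_right (Finset.mem_image_of_mem _ hb) (Finset.mem_image_of_mem _ hb')
    simpa only [card_image_inv_mul hR, (mul_right_injective₀ (inv_ne_zero hR)).eq_iff] using this
  have hterm (l b' : ℝ) : expFun b' ((t - l) / R) * expFun l (R⁻¹ * b) =
      expFun t (R⁻¹ * b') * expFun l (R⁻¹ * b - R⁻¹ * b') := by
    rw [expFun_congr (by ring : b' * ((t - l) / R) = (t - l) * (R⁻¹ * b')), sub_eq_add_neg t,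
      sub_eq_add_neg (R⁻¹ * b), expFun_add_left, expFun_add_right,
      expFun_congr (by ring : -l * (R⁻¹ * b') = l * -(R⁻¹ * b'))]
    ring
  simp only [maskFun, mul_assoc, Finset.sum_mul, hterm, ← Finset.mul_sum]
  rw [Finset.sum_comm]
  simp only [← Finset.mul_sum]
  rw [Finset.sum_congr rfl fun b' hb' => by rw [horth b' hb']]
  simp [hb, hN, mul_comm]

lemma sum_norm_maskFun_sub_div_sq (hR : R ≠ 0) (h : IsSpectrum (B.image fun b => R⁻¹ * b) L)
    (hB : B.Nonempty) (t : ℝ) : ∑ l ∈ L, ‖maskFun B ((t - l) / R)‖ ^ 2 = 1 := by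
  have hN : (B.card : ℂ) ≠ 0 := mod_cast hB.card_ne_zero
  have hstar (l : ℝ) : star (maskFun B ((t - l) / R)) =
      (B.card : ℂ)⁻¹ * ∑ b ∈ B, expFun (-t) (R⁻¹ * b) * expFun l (R⁻¹ * b) := by
    rw [star_maskFun, maskFun]
    congr 1
    refine Finset.sum_congr rfl fun b _ => ?_
    rw [← expFun_add_left]
    exact expFun_congr (by ring)
  have hinv (b : ℝ) (hb : b ∈ B) : expFun (-t) (R⁻¹ * b) *
      ∑ l ∈ L, maskFun B ((t - l) / R) * expFun l (R⁻¹ * b) = 1 := by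
    rw [sum_maskFun_mul_expFun hR h t hb, ← expFun_add_left, neg_add_cancel, expFun_zero_left]
  suffices ∑ l ∈ L, maskFun B ((t - l) / R) * star (maskFun B ((t - l) / R)) = 1 by
    simp only [Complex.star_def, Complex.mul_conj'] at this
    exact_mod_cast this
  calc ∑ l ∈ L, maskFun B ((t - l) / R) * star (maskFun B ((t - l) / R))
      = (B.card : ℂ)⁻¹ * ∑ b ∈ B, expFun (-t) (R⁻¹ * b) *
          ∑ l ∈ L, maskFun B ((t - l) / R) * expFun l (R⁻¹ * b) := by
        simp only [hstar, Finset.mul_sum]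
        rw [Finset.sum_comm]
        exact Finset.sum_congr rfl fun b _ => Finset.sum_congr rfl fun l _ => by ring
    _ = 1 := by rw [Finset.sum_congr rfl hinv]; simp [hN]

lemma sum_norm_maskFun_tau_sq (hR : R ≠ 0) (h : IsSpectrum (B.image fun b => R⁻¹ * b) L)
    (hB : B.Nonempty) (t : ℝ) : ∑ l ∈ L, ‖maskFun B (tau R l t)‖ ^ 2 = 1 := by
  rw [← sum_norm_maskFun_sub_div_sq hR h hB (-t)]
  refine Finset.sum_congr rfl fun l _ => ?_
  rw [← norm_maskFun_neg, show -tau R l t = (-t - l) / R by rw [tau]; ring]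

end Spectrum

section Attractor

variable {R : ℝ} {B : Finset ℝ}

lemma hasSum_digits_iff (hR : R ≠ 0) {d : ℕ → ℝ} {x : ℝ} :
    HasSum (fun k => (R ^ (k + 1))⁻¹ * d k) x ↔
      HasSum (fun k => (R ^ (k + 1))⁻¹ * d (k + 1)) (R * x - d 0) := by
  rw [← hasSum_nat_add_iff' 1, ← hasSum_mul_left_iff hR]
  have hterm (k : ℕ) : R * ((R ^ (k + 1 + 1))⁻¹ * d (k + 1)) = (R ^ (k + 1))⁻¹ * d (k + 1) := by
    rw [← mul_assoc, pow_succ' R (k + 1), mul_inv, mul_inv_cancel_left₀ hR]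
  have hval : R * (x - ∑ k ∈ Finset.range 1, (R ^ (k + 1))⁻¹ * d k) = R * x - d 0 := by
    simp [mul_sub, mul_inv_cancel_left₀ hR]
  simp only [hterm, hval]

lemma mem_attractor_iff (hR : R ≠ 0) {x : ℝ} :
    x ∈ attractor R B ↔ ∃ b ∈ B, ∃ y ∈ attractor R B, tau R b y = x := by
  constructor
  · rintro ⟨d, hd, hx⟩
    refine ⟨d 0, hd 0, _, ⟨fun k => d (k + 1), fun k => hd _, (hasSum_digits_iff hR).1 hx⟩, ?_⟩
    rw [tau, sub_add_cancel, inv_mul_cancel_left₀ hR]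
  · rintro ⟨b, hb, y, ⟨d, hd, hy⟩, rfl⟩
    refine ⟨fun k => k.casesOn b d, Nat.rec hb fun k _ => hd k, (hasSum_digits_iff hR).2 ?_⟩
    rw [tau, mul_inv_cancel_left₀ hR]
    exact (add_sub_cancel_right y b).symm ▸ hy

lemma tau_mem_attractor (hR : R ≠ 0) {b x : ℝ} (hb : b ∈ B) (hx : x ∈ attractor R B) :
    tau R b x ∈ attractor R B :=
  (mem_attractor_iff hR).2 ⟨b, hb, x, hx, rfl⟩

lemma hasSum_inv_pow_succ (hR : 1 < R) : HasSum (fun k : ℕ => (R ^ (k + 1))⁻¹) (R - 1)⁻¹ := by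
  have h := (hasSum_geometric_of_lt_one (inv_nonneg.2 (zero_le_one.trans hR.le))
    (inv_lt_one_of_one_lt₀ hR)).mul_left R⁻¹
  have hval : R⁻¹ * (1 - R⁻¹)⁻¹ = (R - 1)⁻¹ := by
    rw [← mul_inv, mul_sub, mul_one, mul_inv_cancel₀ (by positivity)]
  simpa only [hval, inv_pow, ← mul_inv, ← pow_succ'] using h

lemma isCompact_attractor (hR : 1 < R) (B : Finset ℝ) : IsCompact (attractor R B) := by
  obtain ⟨C, hC⟩ := (B.image fun b => |b|).exists_le
  have hbound (d : ℕ → B) (k : ℕ) : ‖(R ^ (k + 1))⁻¹ * (d k : ℝ)‖ ≤ (R ^ (k + 1))⁻¹ * C := by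
    rw [norm_mul, Real.norm_of_nonneg (by positivity)]
    exact mul_le_mul_of_nonneg_left (hC _ (Finset.mem_image_of_mem _ (d k).2)) (by positivity)
  have hsum : Summable fun k : ℕ => (R ^ (k + 1))⁻¹ * C :=
    (hasSum_inv_pow_succ hR).summable.mul_right C
  have hrange : attractor R B = Set.range fun d : ℕ → B => ∑' k, (R ^ (k + 1))⁻¹ * (d k : ℝ) := by
    ext x
    constructor
    · rintro ⟨d, hd, hx⟩
      exact ⟨fun k => ⟨d k, hd k⟩, hx.tsum_eq⟩
    · rintro ⟨d, rfl⟩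
      exact ⟨fun k => d k, fun k => (d k).2, (hsum.of_norm_bounded (hbound d)).hasSum⟩
  rw [hrange]
  exact isCompact_range (continuous_tsum (fun k => by fun_prop) hsum fun k d => hbound d k)

lemma attractor_subset_Icc (hR : 1 < R) {m M : ℝ} (hB : ∀ b ∈ B, b ∈ Set.Icc m M) :
    attractor R B ⊆ Set.Icc (m / (R - 1)) (M / (R - 1)) := by
  rintro x ⟨d, hd, hx⟩
  have hconst (a : ℝ) : HasSum (fun k : ℕ => (R ^ (k + 1))⁻¹ * a) (a / (R - 1)) := by
    rw [div_eq_inv_mul]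
    exact (hasSum_inv_pow_succ hR).mul_right a
  have hpos (k : ℕ) : 0 ≤ (R ^ (k + 1))⁻¹ := by positivity
  exact ⟨hasSum_le (fun k => mul_le_mul_of_nonneg_left (hB _ (hd k)).1 (hpos k)) (hconst m) hx,
    hasSum_le (fun k => mul_le_mul_of_nonneg_left (hB _ (hd k)).2 (hpos k)) hx (hconst M)⟩

lemma zero_mem_attractor (R : ℝ) (hB : 0 ∈ B) : 0 ∈ attractor R B :=
  ⟨fun _ => 0, fun _ => hB, by simp⟩

lemma dist_tau_tau (hR : 0 < R) (b x y : ℝ) : dist (tau R b x) (tau R b y) = R⁻¹ * dist x y := by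
  rw [tau, tau, Real.dist_eq, Real.dist_eq, ← mul_sub, add_sub_add_right_eq_sub, abs_mul,
    abs_of_pos (inv_pos.2 hR)]

lemma infDist_tau_le (hR : 1 < R) {b : ℝ} (hb : b ∈ B) (x : ℝ) :
    Metric.infDist (tau R b x) (attractor R B) ≤ R⁻¹ * Metric.infDist x (attractor R B) := by
  obtain hX | hX := (attractor R B).eq_empty_or_nonempty
  · simp [hX]
  obtain ⟨y, hy, hxy⟩ := (isCompact_attractor hR B).exists_infDist_eq_dist hX x
  rw [hxy, ← dist_tau_tau (zero_lt_one.trans hR) b]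
  exact Metric.infDist_le_dist_of_mem (tau_mem_attractor (by positivity) hb hy)

end Attractor

section ExtremeCycles

variable {R : ℝ} {B L : Finset ℝ} {p : ℕ} {c : ℕ → ℝ}

lemma IsExtremeCycleSeq.exists_tau_eq (h : IsExtremeCycleSeq R B L p c) {i : ℕ} (hi : i < p) :
    ∃ l ∈ L, c (i + 1) = tau R l (c i) := by
  obtain ⟨⟨l, hl, hc⟩, -⟩ := h.2.2 i hi
  exact ⟨l, hl, by rw [hc, tau, inv_mul_eq_div]⟩

lemma IsExtremeCycleSeq.norm_maskFun_succ (h : IsExtremeCycleSeq R B L p c) {i : ℕ} (hi : i < p) :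
    ‖maskFun B (c (i + 1))‖ = 1 := by
  obtain hlt | heq := Nat.lt_or_eq_of_le (Nat.succ_le_of_lt hi)
  · exact (h.2.2 _ hlt).2
  · rw [Nat.succ_eq_add_one] at heq
    rw [heq, h.2.1]
    exact (h.2.2 0 h.1).2

lemma IsExtremeCycleSeq.mem_attractor (h : IsExtremeCycleSeq R B L p c) (hR : 1 < R)
    (hL : (attractor R L).Nonempty) {i : ℕ} (hi : i ≤ p) : c i ∈ attractor R L := by
  have hR0 : 0 < R := by positivity
  have hdist : ∀ i ≤ p, Metric.infDist (c i) (attractor R L) ≤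
      R⁻¹ ^ i * Metric.infDist (c 0) (attractor R L) := by
    intro i hi
    induction i with
    | zero => simp
    | succ i ih =>
      obtain ⟨l, hl, hc⟩ := h.exists_tau_eq hi
      rw [hc, pow_succ', mul_assoc]
      exact (infDist_tau_le hR hl _).trans
        (mul_le_mul_of_nonneg_left (ih (Nat.le_of_succ_le hi)) (inv_nonneg.2 hR0.le))
  have hzero : Metric.infDist (c 0) (attractor R L) = 0 := by
    have hp := hdist p le_rfl
    rw [h.2.1] at hp
    nlinarith [Metric.infDist_nonneg (x := c 0) (s := attractor R L),
      pow_lt_one₀ (inv_nonneg.2 hR0.le) (inv_lt_one_of_one_lt₀ hR) h.1.ne']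
  rw [(isCompact_attractor hR L).isClosed.mem_iff_infDist_zero hL]
  refine le_antisymm ?_ Metric.infDist_nonneg
  simpa [hzero] using hdist i hi

lemma eq_zero_of_norm_maskFun_tau_eq_one (hR : R ≠ 0)
    (hspec : IsSpectrum (B.image fun b => R⁻¹ * b) L) (hB : B.Nonempty) (hL : 0 ∈ L) {t l : ℝ}
    (hl : l ∈ L) (ht : maskFun B (t / R) ≠ 0) (h : ‖maskFun B (tau R l t)‖ = 1) : l = 0 := by
  by_contra hne
  have hle := Finset.sum_le_sum_of_subset_of_nonneg (f := fun l => ‖maskFun B (tau R l t)‖ ^ 2)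
    (Finset.insert_subset hl (Finset.singleton_subset_iff.2 hL)) fun _ _ _ => sq_nonneg _
  rw [sum_norm_maskFun_tau_sq hR hspec hB, Finset.sum_pair hne, h, tau, add_zero,
    inv_mul_eq_div] at hle
  have := norm_pos_iff.2 ht
  nlinarith

lemma IsExtremeCycleSeq.eq_zero (h : IsExtremeCycleSeq R B L p c) (hR : 1 < R)
    (hspec : IsSpectrum (B.image fun b => R⁻¹ * b) L) (hB : B.Nonempty) (hL : 0 ∈ L)
    (hmask : ∀ t ∈ attractor R L, maskFun B (t / R) ≠ 0) {i : ℕ} (hi : i ≤ p) : c i = 0 := by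
  have hR0 : 0 < R := by positivity
  have hpow : ∀ i ≤ p, R ^ i * c i = c 0 := by
    intro i hi
    induction i with
    | zero => simp
    | succ i ih =>
      obtain ⟨l, hl, hc⟩ := h.exists_tau_eq hi
      have hnorm := h.norm_maskFun_succ hi
      rw [hc] at hnorm
      have hci := h.mem_attractor hR ⟨0, zero_mem_attractor R hL⟩ (Nat.le_of_succ_le hi)
      obtain rfl := eq_zero_of_norm_maskFun_tau_eq_one hR0.ne' hspec hB hL hl (hmask _ hci) hnorm
      rw [hc, tau, add_zero, pow_succ, mul_assoc, mul_inv_cancel_left₀ hR0.ne']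
      exact ih (Nat.le_of_succ_le hi)
  have hzero : c 0 = 0 := by
    have hp := hpow p le_rfl
    rw [h.2.1] at hp
    by_contra hne
    exact (one_lt_pow₀ hR h.1.ne').ne' ((mul_eq_right₀ hne).1 hp)
  have hci := hpow i hi
  rw [hzero] at hci
  exact (mul_eq_zero.1 hci).resolve_left (by positivity)

lemma isExtremeCycleSeq_zero (R : ℝ) (hB : B.Nonempty) (hL : 0 ∈ L) :
    IsExtremeCycleSeq R B L 1 fun _ => 0 :=
  ⟨one_pos, rfl, fun _ _ => ⟨⟨0, hL, by simp⟩, by simp [maskFun_zero hB]⟩⟩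

lemma isExtremeCyclePoint_iff (hR : 1 < R) (hspec : IsSpectrum (B.image fun b => R⁻¹ * b) L)
    (hB : B.Nonempty) (hL : 0 ∈ L) (hmask : ∀ t ∈ attractor R L, maskFun B (t / R) ≠ 0) {x : ℝ} :
    IsExtremeCyclePoint R B L x ↔ x = 0 := by
  constructor
  · rintro ⟨p, c, hc, rfl⟩
    exact hc.eq_zero hR hspec hB hL hmask (Nat.zero_le p)
  · rintro rfl
    exact ⟨1, _, isExtremeCycleSeq_zero R hB hL, rfl⟩

lemma isExtremeCycle_iff (hR : 1 < R) (hspec : IsSpectrum (B.image fun b => R⁻¹ * b) L)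
    (hB : B.Nonempty) (hL : 0 ∈ L) (hmask : ∀ t ∈ attractor R L, maskFun B (t / R) ≠ 0)
    {C : Set ℝ} : IsExtremeCycle R B L C ↔ C = {0} := by
  constructor
  · rintro ⟨p, c, hc, rfl⟩
    refine Set.eq_singleton_iff_nonempty_unique_mem.2 ⟨⟨c 0, 0, hc.1, rfl⟩, ?_⟩
    rintro _ ⟨i, hi, rfl⟩
    exact hc.eq_zero hR hspec hB hL hmask (Nat.le_of_lt hi)
  · rintro rfl
    exact ⟨1, _, isExtremeCycleSeq_zero R hB hL, by simp⟩

end ExtremeCycles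

lemma tendsto_measure_gt_atTop {α : Type*} [MeasurableSpace α] (μ : Measure α) [IsFiniteMeasure μ]
    {f : α → ℝ} (hf : Measurable f) :
    Filter.Tendsto (fun c => μ {x | c < f x}) Filter.atTop (𝓝 0) := by
  have hempty : ⋂ c : ℝ, {x | c < f x} = ∅ :=
    Set.eq_empty_of_forall_notMem fun x hx => lt_irrefl (f x) (Set.mem_iInter.1 hx (f x))
  rw [← measure_empty (μ := μ), ← hempty]
  exact tendsto_measure_iInter_atTop
    (fun c => (measurableSet_lt measurable_const hf).nullMeasurableSet)
    (fun c d hcd x (hx : d < f x) => hcd.trans_lt hx) ⟨0, measure_ne_top _ _⟩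

section InvariantMeasure

variable {R : ℝ} {B : Finset ℝ} {μ : Measure ℝ}

lemma continuous_tau (R b : ℝ) : Continuous (tau R b) := by
  unfold tau
  fun_prop

lemma measurableEmbedding_tau (hR : R ≠ 0) (b : ℝ) : MeasurableEmbedding (tau R b) :=
  (measurableEmbedding_mulLeft₀ (inv_ne_zero hR)).comp (measurableEmbedding_addRight b)

lemma measurable_shiftMap (hR : 1 < R) (B : Finset ℝ) : Measurable (shiftMap R B) := by
  classical
  have hpattern : Measurable fun x (b : B) => x ∈ tau R b '' attractor R B :=
    measurable_pi_lambda _ fun b =>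
      ((isCompact_attractor hR B).image (continuous_tau R b)).measurableSet.mem
  let G : (B → Prop) × ℝ → ℝ := fun q =>
    if h : ∃ b, ∃ hb : b ∈ B, q.1 ⟨b, hb⟩ then R * q.2 - h.choose else 0
  have hG : Measurable G := by
    refine measurable_from_prod_countable_right fun s => ?_
    simp only [G]
    split_ifs with h
    · exact (measurable_const_mul R).sub_const h.choose
    · exact measurable_const
  have hfactor : shiftMap R B = fun x => G (fun b => x ∈ tau R b '' attractor R B, x) := by
    funext x
    simp only [shiftMap, G, exists_prop]
  rw [hfactor]
  exact hG.comp (hpattern.prodMk measurable_id)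

lemma NoOverlap.ae_shiftMap_eq (h : NoOverlap R B μ) :
    ∀ᵐ x ∂μ, ∀ b ∈ B, x ∈ tau R b '' attractor R B → shiftMap R B x = R * x - b := by
  have hdisj : ∀ᵐ x ∂μ, ∀ b ∈ B, ∀ b' ∈ B, b ≠ b' →
      ¬(x ∈ tau R b '' attractor R B ∧ x ∈ tau R b' '' attractor R B) := by
    simp only [Filter.eventually_all_finset, Filter.eventually_imp_distrib_left]
    exact fun b hb b' hb' hne => measure_eq_zero_iff_ae_notMem.1 (h b hb b' hb' hne)
  filter_upwards [hdisj] with x hx b hb hxb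
  have hex : ∃ b, b ∈ B ∧ x ∈ tau R b '' attractor R B := ⟨b, hb, hxb⟩
  rw [shiftMap, dif_pos hex]
  by_contra hne
  exact hx b hb _ hex.choose_spec.1 (fun heq => hne (by rw [← heq])) ⟨hxb, hex.choose_spec.2⟩

namespace IsInvariantMeasure

variable [IsProbabilityMeasure μ]

lemma eq_smul_sum_map (h : IsInvariantMeasure R B μ) :
    μ = (B.card : ℝ≥0)⁻¹ • ∑ b ∈ B, μ.map (tau R b) := by
  have hm (b : ℝ) : AEMeasurable (tau R b) μ := (continuous_tau R b).aemeasurable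
  refine Measure.ext_of_integral_eq_on_compactlySupported fun f => ?_
  rw [integral_smul_nnreal_measure,
    integral_finsetSum_measure (f := f) fun b _ =>
      f.continuous.integrable_of_hasCompactSupport f.hasCompactSupport,
    h f f.continuous f.hasCompactSupport]
  have hmap (b : ℝ) : ∫ x, f x ∂μ.map (tau R b) = ∫ x, f (tau R b x) ∂μ :=
    integral_map (hm b) f.continuous.aestronglyMeasurable
  simp [hmap, NNReal.smul_def]

lemma nonempty_digits (h : IsInvariantMeasure R B μ) : B.Nonempty := by
  rw [Finset.nonempty_iff_ne_empty]
  rintro rfl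
  exact IsProbabilityMeasure.ne_zero μ (by simpa using h.eq_smul_sum_map)

lemma ae_iff (h : IsInvariantMeasure R B μ) (hR : R ≠ 0) {P : ℝ → Prop} :
    (∀ᵐ x ∂μ, P x) ↔ ∀ b ∈ B, ∀ᵐ y ∂μ, P (tau R b y) := by
  have hc : (B.card : ℝ≥0)⁻¹ ≠ 0 := by simp [h.nonempty_digits.card_ne_zero]
  conv_lhs => rw [h.eq_smul_sum_map]
  rw [Measure.ae_smul_measure_iff hc, ae_finsetSum_measure_iff]
  exact forall₂_congr fun b _ => (measurableEmbedding_tau hR b).ae_map_iff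

lemma measure_le (h : IsInvariantMeasure R B μ) (hR : R ≠ 0) {s t : Set ℝ}
    (hst : ∀ b ∈ B, tau R b ⁻¹' s ≤ᵐ[μ] t) : μ s ≤ μ t := by
  calc μ s = (B.card : ℝ≥0)⁻¹ • ∑ b ∈ B, μ (tau R b ⁻¹' s) := by
        conv_lhs => rw [h.eq_smul_sum_map]
        simp only [Measure.smul_apply, Measure.finsetSum_apply,
          (measurableEmbedding_tau hR _).map_apply]
    _ ≤ (B.card : ℝ≥0)⁻¹ • ∑ _b ∈ B, μ t := by
        exact smul_le_smul_of_nonneg_left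
          (Finset.sum_le_sum fun b hb => measure_mono_ae (hst b hb)) zero_le
    _ = μ t := by
        rw [Finset.sum_const, ← Nat.cast_smul_eq_nsmul ℝ≥0, smul_smul, inv_mul_cancel₀, one_smul]
        exact mod_cast h.nonempty_digits.card_ne_zero

lemma integral_eq (h : IsInvariantMeasure R B μ) (hR : R ≠ 0) {F : ℝ → ℂ} (hF : Integrable F μ) :
    ∫ x, F x ∂μ = (B.card : ℂ)⁻¹ * ∑ b ∈ B, ∫ y, F (tau R b y) ∂μ := by
  have hc : (B.card : ℝ≥0)⁻¹ ≠ 0 := by simp [h.nonempty_digits.card_ne_zero]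
  have hsum : Integrable F (∑ b ∈ B, μ.map (tau R b)) := by
    rw [h.eq_smul_sum_map] at hF
    exact (integrable_smul_measure (by simpa using hc) (by simp)).1 hF
  conv_lhs => rw [h.eq_smul_sum_map]
  rw [integral_smul_nnreal_measure,
    integral_finsetSum_measure (integrable_finsetSum_measure.1 hsum)]
  simp only [(measurableEmbedding_tau hR _).integral_map]
  simp [NNReal.smul_def]

lemma ae_mem_attractor (h : IsInvariantMeasure R B μ) (hR : 1 < R) :
    ∀ᵐ x ∂μ, x ∈ attractor R B := by
  have hR0 : 0 < R := zero_lt_one.trans hR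
  set X := attractor R B
  have hX : X.Nonempty := by
    obtain ⟨b, hb⟩ := h.nonempty_digits
    exact ⟨_, fun _ => b, fun _ => hb, (hasSum_inv_pow_succ hR).mul_right b⟩
  have hstep (t : ℝ) : μ {x | t < Metric.infDist x X} ≤ μ {x | R * t < Metric.infDist x X} := by
    refine h.measure_le hR0.ne' fun b hb => Filter.Eventually.of_forall fun x hx => ?_
    exact (lt_inv_mul_iff₀ hR0).1 (hx.trans_le (infDist_tau_le hR hb x))
  have hpow (t : ℝ) (n : ℕ) :
      μ {x | t < Metric.infDist x X} ≤ μ {x | R ^ n * t < Metric.infDist x X} := by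
    induction n with
    | zero => simp
    | succ n ih => simpa only [pow_succ', mul_assoc] using ih.trans (hstep _)
  have hnull (t : ℝ) (ht : 0 < t) : μ {x | t < Metric.infDist x X} = 0 := by
    have hlim := (tendsto_measure_gt_atTop μ (Metric.continuous_infDist_pt X).measurable).comp
      ((tendsto_pow_atTop_atTop_of_one_lt hR).atTop_mul_const ht)
    exact nonpos_iff_eq_zero.1 (ge_of_tendsto' hlim (hpow t))
  have hall : ∀ᵐ x ∂μ, ∀ n : ℕ, Metric.infDist x X ≤ 1 / (n + 1) :=
    ae_all_iff.2 fun n => by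
      simpa only [Set.mem_ofPred_eq, not_lt] using
        measure_eq_zero_iff_ae_notMem.1 (hnull _ (Nat.one_div_pos_of_nat (n := n)))
  filter_upwards [hall] with x hx
  rw [(isCompact_attractor hR B).isClosed.mem_iff_infDist_zero hX]
  exact le_antisymm (ge_of_tendsto' tendsto_one_div_add_atTop_nhds_zero_nat hx)
    Metric.infDist_nonneg

lemma ae_shiftMap_tau (h : IsInvariantMeasure R B μ) (hR : 1 < R) (hno : NoOverlap R B μ) {b : ℝ}
    (hb : b ∈ B) : ∀ᵐ y ∂μ, shiftMap R B (tau R b y) = y := by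
  have hR0 : R ≠ 0 := by positivity
  filter_upwards [h.ae_mem_attractor hR, (h.ae_iff hR0).1 hno.ae_shiftMap_eq b hb] with y hy hshift
  rw [hshift b hb ⟨y, hy, rfl⟩, tau, mul_inv_cancel_left₀ hR0, add_sub_cancel_right]

lemma measurePreserving_shiftMap (h : IsInvariantMeasure R B μ) (hR : 1 < R)
    (hno : NoOverlap R B μ) : MeasurePreserving (shiftMap R B) μ μ := by
  have hr := measurable_shiftMap hR B
  have := Measure.isProbabilityMeasure_map (μ := μ) hr.aemeasurable
  refine ⟨hr, Measure.eq_of_le_of_isProbabilityMeasure (Measure.le_iff.2 fun s hs => ?_)⟩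
  rw [Measure.map_apply hr hs]
  refine h.measure_le (by positivity) fun b hb => ?_
  filter_upwards [h.ae_shiftMap_tau hR hno hb] with y hy (hys : shiftMap R B (tau R b y) ∈ s)
  rwa [hy] at hys

lemma integral_expFun_mul_comp_shiftMap (h : IsInvariantMeasure R B μ) (hR : 1 < R)
    (hno : NoOverlap R B μ) (s : ℝ) {F : ℝ → ℂ} (hF : Integrable F μ) :
    ∫ x, expFun s x * F (shiftMap R B x) ∂μ =
      maskFun B (s / R) * ∫ x, expFun (s / R) x * F x ∂μ := by
  have hint : Integrable (fun x => expFun s x * F (shiftMap R B x)) μ :=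
    ((h.measurePreserving_shiftMap hR hno).integrable_comp_of_integrable hF).bdd_mul
      (continuous_expFun s).aestronglyMeasurable (.of_forall fun x => (norm_expFun s x).le)
  rw [h.integral_eq (by positivity) hint, maskFun, mul_assoc, Finset.sum_mul]
  congr 1
  refine Finset.sum_congr rfl fun b hb => ?_
  rw [← integral_const_mul]
  refine integral_congr_ae ?_
  filter_upwards [h.ae_shiftMap_tau hR hno hb] with y hy
  rw [hy, expFun_congr (by rw [tau]; ring : s * tau R b y = s / R * (y + b)), expFun_add_right,
    expFun_congr (by ring : s / R * b = b * (s / R))]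
  ring

end IsInvariantMeasure

end InvariantMeasure

section Exponentials

variable {μ : Measure ℝ}

lemma integrable_expFun_mul (t : ℝ) {F : ℝ → ℂ} (hF : Integrable F μ) :
    Integrable (fun x => expFun t x * F x) μ :=
  hF.bdd_mul (continuous_expFun t).aestronglyMeasurable (.of_forall fun x => (norm_expFun t x).le)

lemma charFun_withDensity_ofReal {g : ℝ → ℝ} (hg : AEMeasurable g μ) (t : ℝ) :
    charFun (μ.withDensity fun x => ENNReal.ofReal (g x)) t =
      ∫ x, expFun (t / (2 * Real.pi)) x * ((max (g x) 0 : ℝ) : ℂ) ∂μ := by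
  have hexp (x : ℝ) : Complex.exp (t * x * Complex.I) = expFun (t / (2 * Real.pi)) x := by
    have hpi : (Real.pi : ℂ) ≠ 0 := mod_cast Real.pi_ne_zero
    rw [expFun]
    push_cast
    field_simp
  rw [charFun_apply_real, integral_withDensity_eq_integral_toReal_smul₀ hg.ennreal_ofReal
    (.of_forall fun _ => ENNReal.ofReal_lt_top)]
  simp only [ENNReal.toReal_ofReal', Complex.real_smul, hexp,
    fun x => mul_comm ((max (g x) 0 : ℝ) : ℂ)]

lemma ae_eq_zero_of_integral_expFun_mul_ofReal {g : ℝ → ℝ} (hg : Integrable g μ)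
    (h : ∀ t, ∫ x, expFun t x * (g x : ℂ) ∂μ = 0) : g =ᵐ[μ] 0 := by
  have := isFiniteMeasure_withDensity_ofReal hg.2
  have := isFiniteMeasure_withDensity_ofReal hg.neg.2
  have hparts (x : ℝ) : g x = max (g x) 0 - max (-g x) 0 := (posPart_sub_negPart (g x)).symm
  have hpos : Integrable (fun x => ((max (g x) 0 : ℝ) : ℂ)) μ := hg.pos_part.ofReal
  have hneg : Integrable (fun x => ((max (-g x) 0 : ℝ) : ℂ)) μ := hg.neg_part.ofReal
  have hdensity : (μ.withDensity fun x => ENNReal.ofReal (g x)) =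
      μ.withDensity fun x => ENNReal.ofReal (-g x) := by
    refine Measure.ext_of_charFun (funext fun t => sub_eq_zero.1 ?_)
    rw [charFun_withDensity_ofReal hg.aemeasurable,
      charFun_withDensity_ofReal (g := fun x => -g x) hg.neg.aemeasurable,
      ← integral_sub (integrable_expFun_mul _ hpos) (integrable_expFun_mul _ hneg),
      ← h (t / (2 * Real.pi))]
    refine integral_congr_ae (.of_forall fun x => ?_)
    dsimp only
    rw [← mul_sub, ← Complex.ofReal_sub, ← hparts]
  have hfin : ∫⁻ x, ENNReal.ofReal (g x) ∂μ ≠ ∞ :=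
    ((lintegral_mono fun x => Real.ofReal_le_enorm (g x)).trans_lt hg.2).ne
  filter_upwards [(withDensity_eq_iff hg.aemeasurable.ennreal_ofReal
    hg.neg.aemeasurable.ennreal_ofReal hfin).1 hdensity] with x hx
  rw [hparts x, ← ENNReal.toReal_ofReal', ← ENNReal.toReal_ofReal', hx]
  exact sub_self _

lemma ae_eq_zero_of_integral_expFun_mul {F : ℝ → ℂ} (hF : Integrable F μ)
    (h : ∀ t, ∫ x, expFun t x * F x ∂μ = 0) : F =ᵐ[μ] 0 := by
  have hstar : ∀ t, ∫ x, expFun t x * star (F x) ∂μ = 0 := by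
    intro t
    calc ∫ x, expFun t x * star (F x) ∂μ
        = ∫ x, star (expFun (-t) x * F x) ∂μ := by simp only [star_mul', star_expFun, neg_neg]
      _ = star (∫ x, expFun (-t) x * F x ∂μ) := integral_conj
      _ = 0 := by rw [h, star_zero]
  have hFstar : Integrable (fun x => star (F x)) μ := Complex.conjCLE.integrable_comp_iff.2 hF
  have hre : (fun x => (F x).re) =ᵐ[μ] 0 := by
    refine ae_eq_zero_of_integral_expFun_mul_ofReal hF.re fun t => ?_
    have hsplit (x : ℝ) : expFun t x * ((F x).re : ℂ) =
        2⁻¹ * (expFun t x * F x + expFun t x * star (F x)) := by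
      rw [Complex.re_eq_add_conj, Complex.star_def]
      ring
    simp only [hsplit]
    rw [integral_const_mul, integral_add (integrable_expFun_mul t hF)
      (integrable_expFun_mul t hFstar), h, hstar, add_zero, mul_zero]
  have him : (fun x => (F x).im) =ᵐ[μ] 0 := by
    refine ae_eq_zero_of_integral_expFun_mul_ofReal hF.im fun t => ?_
    have hsplit (x : ℝ) : expFun t x * ((F x).im : ℂ) =
        (2 * Complex.I)⁻¹ * (expFun t x * F x - expFun t x * star (F x)) := by
      rw [Complex.im_eq_sub_conj, Complex.star_def]
      ring
    simp only [hsplit]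
    rw [integral_const_mul, integral_sub (integrable_expFun_mul t hF)
      (integrable_expFun_mul t hFstar), h, hstar, sub_zero, mul_zero]
  filter_upwards [hre, him] with x hxre hxim
  exact Complex.ext hxre hxim

variable [IsFiniteMeasure μ]

lemma memLp_expFun (μ : Measure ℝ) [IsFiniteMeasure μ] (t : ℝ) : MemLp (expFun t) 2 μ :=
  .of_bound (continuous_expFun t).aestronglyMeasurable 1 (.of_forall fun x => (norm_expFun t x).le)

/-- The exponential function `e_t` as a vector of `L²(μ)`. -/
noncomputable def expLp (μ : Measure ℝ) [IsFiniteMeasure μ] (t : ℝ) : Lp ℂ 2 μ :=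
  (memLp_expFun μ t).toLp (expFun t)

lemma coeFn_expLp (t : ℝ) : expLp μ t =ᵐ[μ] expFun t := (memLp_expFun μ t).coeFn_toLp

lemma expLp_zero : expLp μ 0 = Lp.const 2 μ 1 := by
  refine Lp.ext ?_
  filter_upwards [coeFn_expLp (μ := μ) 0, Lp.coeFn_const 2 μ (1 : ℂ)] with x hexp hconst
  rw [hexp, hconst, expFun_zero_left, Function.const_apply]

lemma inner_expLp (t : ℝ) (f : Lp ℂ 2 μ) :
    ⟪expLp μ t, f⟫_ℂ = ∫ x, expFun (-t) x * f x ∂μ := by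
  rw [L2.inner_def]
  refine integral_congr_ae ?_
  filter_upwards [coeFn_expLp (μ := μ) t] with x hx
  rw [hx, RCLike.inner_apply', ← star_expFun, Complex.star_def]

lemma inner_expLp_expLp (s t : ℝ) : ⟪expLp μ s, expLp μ t⟫_ℂ = ∫ x, expFun (t - s) x ∂μ := by
  rw [inner_expLp]
  refine integral_congr_ae ?_
  filter_upwards [coeFn_expLp (μ := μ) t] with x hx
  rw [hx, ← expFun_add_left, neg_add_eq_sub]

lemma eq_zero_of_inner_expLp {f : Lp ℂ 2 μ} (h : ∀ t, ⟪expLp μ t, f⟫_ℂ = 0) : f = 0 := by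
  refine (Lp.eq_zero_iff_ae_eq_zero).2 (ae_eq_zero_of_integral_expFun_mul
    ((Lp.memLp f).integrable one_le_two) fun t => ?_)
  rw [← neg_neg t, ← inner_expLp, h]

lemma continuous_expLp : Continuous (expLp μ) := by
  have hcont : Continuous fun t => ∫ x, expFun t x ∂μ :=
    continuous_of_dominated (fun t => (continuous_expFun t).aestronglyMeasurable)
      (fun t => .of_forall fun x => (norm_expFun t x).le) (integrable_const 1)
      (.of_forall fun x => by unfold expFun; fun_prop)
  have hsq (s t : ℝ) : ‖expLp μ s - expLp μ t‖ ^ 2 =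
      2 * (∫ x, expFun 0 x ∂μ).re - 2 * (∫ x, expFun (t - s) x ∂μ).re := by
    have hnorm (t : ℝ) : ‖expLp μ t‖ ^ 2 = (∫ x, expFun 0 x ∂μ).re := by
      rw [← inner_self_eq_norm_sq (𝕜 := ℂ), inner_expLp_expLp, sub_self]
      rfl
    rw [norm_sub_sq (𝕜 := ℂ), inner_expLp_expLp, hnorm, hnorm, RCLike.re_eq_complex_re]
    ring
  refine continuous_iff_continuousAt.2 fun t => tendsto_iff_norm_sub_tendsto_zero.2 ?_
  have hdiff : Continuous fun s => ‖expLp μ s - expLp μ t‖ ^ 2 := by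
    simp only [hsq]
    exact continuous_const.sub (continuous_const.mul
      (Complex.continuous_re.comp (hcont.comp (continuous_const.sub continuous_id))))
  simpa using (hdiff.tendsto' t 0 (by simp)).sqrt

end Exponentials

section WordOrbit

variable {𝕜 H ι : Type*} [RCLike 𝕜] [NormedAddCommGroup H] [InnerProductSpace 𝕜 H]

/-- The orbit of `v` under the monoid generated by the isometries `S i`, i.e. the set of all
`S i₁ (S i₂ (⋯ (S iₙ v)))`, with `v` itself for the empty word. -/
def wordOrbit (S : ι → H →ₗᵢ[𝕜] H) (v : H) : Set H :=
  Set.range fun w : List ι => w.foldr (fun i x => S i x) v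

variable {S : ι → H →ₗᵢ[𝕜] H} {v x y : H} {i₀ : ι}

lemma self_mem_wordOrbit (S : ι → H →ₗᵢ[𝕜] H) (v : H) : v ∈ wordOrbit S v := ⟨[], rfl⟩

lemma map_mem_wordOrbit (i : ι) (hx : x ∈ wordOrbit S v) : S i x ∈ wordOrbit S v := by
  obtain ⟨w, rfl⟩ := hx
  exact ⟨i :: w, rfl⟩

@[elab_as_elim]
lemma wordOrbit_induction {p : ∀ x, x ∈ wordOrbit S v → Prop} (self : p v (self_mem_wordOrbit S v))
    (map : ∀ i x hx, p x hx → p (S i x) (map_mem_wordOrbit i hx)) (hx : x ∈ wordOrbit S v) :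
    p x hx := by
  obtain ⟨w, rfl⟩ := hx
  induction w with
  | nil => exact self
  | cons i w ih => exact map i _ ⟨w, rfl⟩ ih

lemma exists_map_eq_of_mem_wordOrbit (hv : S i₀ v = v) (hx : x ∈ wordOrbit S v) :
    ∃ i, ∃ y ∈ wordOrbit S v, S i y = x := by
  induction hx using wordOrbit_induction with
  | self => exact ⟨i₀, v, self_mem_wordOrbit S v, hv⟩
  | map i y hy => exact ⟨i, y, hy, rfl⟩

lemma norm_eq_of_mem_wordOrbit (hx : x ∈ wordOrbit S v) : ‖x‖ = ‖v‖ := by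
  induction hx using wordOrbit_induction with
  | self => rfl
  | map i y _ ih => rw [LinearIsometry.norm_map, ih]

lemma eq_or_inner_eq_zero_map (hS : OrthogonalFamily 𝕜 (fun _ => H) S) (i j : ι)
    (h : x = y ∨ ⟪x, y⟫_𝕜 = 0) : S i x = S j y ∨ ⟪S i x, S j y⟫_𝕜 = 0 := by
  obtain rfl | hij := eq_or_ne i j
  · rwa [(S i).injective.eq_iff, LinearIsometry.inner_map_map]
  · exact .inr (hS hij x y)

lemma eq_or_inner_eq_zero_of_mem_wordOrbit (hS : OrthogonalFamily 𝕜 (fun _ => H) S)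
    (hv : S i₀ v = v) (hx : x ∈ wordOrbit S v) (hy : y ∈ wordOrbit S v) :
    x = y ∨ ⟪x, y⟫_𝕜 = 0 := by
  induction hx using wordOrbit_induction generalizing y with
  | self =>
    induction hy using wordOrbit_induction with
    | self => exact .inl rfl
    | map j z _ ih =>
      have h := eq_or_inner_eq_zero_map hS i₀ j ih
      rwa [hv] at h
  | map i x _ ih =>
    obtain ⟨j, z, hz, rfl⟩ := exists_map_eq_of_mem_wordOrbit hv hy
    exact eq_or_inner_eq_zero_map hS i j (ih hz)

lemma orthonormal_wordOrbit (hS : OrthogonalFamily 𝕜 (fun _ => H) S) (hv : S i₀ v = v)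
    (hnorm : ‖v‖ = 1) : Orthonormal 𝕜 ((↑) : wordOrbit S v → H) :=
  ⟨fun x => (norm_eq_of_mem_wordOrbit x.2).trans hnorm, fun x y hxy =>
    (eq_or_inner_eq_zero_of_mem_wordOrbit hS hv x.2 y.2).resolve_left fun h => hxy (Subtype.ext h)⟩

lemma map_mem_orthogonal_wordOrbit (hS : OrthogonalFamily 𝕜 (fun _ => H) S) (hv : S i₀ v = v)
    (i : ι) (hx : x ∈ (Submodule.span 𝕜 (wordOrbit S v))ᗮ) :
    S i x ∈ (Submodule.span 𝕜 (wordOrbit S v))ᗮ := by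
  rw [Submodule.mem_orthogonal] at hx
  have hle : Submodule.span 𝕜 (wordOrbit S v) ≤ (𝕜 ∙ S i x)ᗮ := by
    refine Submodule.span_le.2 fun y hy => Submodule.mem_orthogonal_singleton_iff_inner_left.2 ?_
    obtain ⟨j, z, hz, rfl⟩ := exists_map_eq_of_mem_wordOrbit hv hy
    obtain rfl | hij := eq_or_ne i j
    · rw [LinearIsometry.inner_map_map]
      exact hx z (Submodule.subset_span hz)
    · exact hS hij.symm z x
  exact fun y hy => Submodule.mem_orthogonal_singleton_iff_inner_left.1 (hle hy)

variable [CompleteSpace H]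

lemma map_mem_orthogonal_orthogonal_wordOrbit (i : ι)
    (hx : x ∈ (Submodule.span 𝕜 (wordOrbit S v))ᗮᗮ) :
    S i x ∈ (Submodule.span 𝕜 (wordOrbit S v))ᗮᗮ := by
  rw [Submodule.orthogonal_orthogonal_eq_closure] at hx ⊢
  have hmap : Submodule.span 𝕜 (wordOrbit S v) ≤
      (Submodule.span 𝕜 (wordOrbit S v)).comap (S i).toLinearMap :=
    Submodule.span_le.2 fun y hy => Submodule.subset_span (map_mem_wordOrbit i hy)
  exact map_mem_closure (S i).continuous hx hmap

lemma starProjection_orthogonal_wordOrbit_map (hS : OrthogonalFamily 𝕜 (fun _ => H) S)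
    (hv : S i₀ v = v) (i : ι) (x : H) :
    (Submodule.span 𝕜 (wordOrbit S v))ᗮ.starProjection (S i x) =
      S i ((Submodule.span 𝕜 (wordOrbit S v))ᗮ.starProjection x) := by
  refine Submodule.eq_starProjection_of_mem_orthogonal
    (map_mem_orthogonal_wordOrbit hS hv i (Submodule.starProjection_apply_mem _ x)) ?_
  rw [← map_sub]
  exact map_mem_orthogonal_orthogonal_wordOrbit i (Submodule.sub_starProjection_mem_orthogonal x)

lemma norm_starProjection_orthogonal_wordOrbit_sum_sq
    (hS : OrthogonalFamily 𝕜 (fun _ => H) S) (hv : S i₀ v = v) (s : Finset ι) (a : ι → 𝕜)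
    (y : ι → H) :
    ‖(Submodule.span 𝕜 (wordOrbit S v))ᗮ.starProjection (∑ i ∈ s, a i • S i (y i))‖ ^ 2 =
      ∑ i ∈ s, ‖a i‖ ^ 2 * ‖(Submodule.span 𝕜 (wordOrbit S v))ᗮ.starProjection (y i)‖ ^ 2 := by
  simp only [map_sum, map_smul, starProjection_orthogonal_wordOrbit_map hS hv, ← mul_pow,
    ← norm_smul]
  simp only [← map_smul]
  exact hS.norm_sum _ s

lemma exists_hilbertBasis_wordOrbit (hS : OrthogonalFamily 𝕜 (fun _ => H) S) (hv : S i₀ v = v)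
    (hnorm : ‖v‖ = 1) (htotal : (Submodule.span 𝕜 (wordOrbit S v))ᗮ = ⊥) :
    ∃ e : HilbertBasis (wordOrbit S v) 𝕜 H, ∀ x, e x = (x : H) := by
  have horth := orthonormal_wordOrbit hS hv hnorm
  rw [← Subtype.range_coe (s := wordOrbit S v)] at htotal
  exact ⟨.mkOfOrthogonalEqBot horth htotal,
    congrFun (HilbertBasis.coe_mkOfOrthogonalEqBot horth htotal)⟩

end WordOrbit

section MaximumPrinciple

variable {R : ℝ} {L : Finset ℝ} {w u : ℝ → ℝ} {c t : ℝ}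

lemma le_of_forall_tau_le (hw : ∀ t, 0 ≤ w t) (hsum : ∑ l ∈ L, w (tau R l t) = 1)
    (hu : u t = ∑ l ∈ L, w (tau R l t) * u (tau R l t)) (hc : ∀ l ∈ L, u (tau R l t) ≤ c) :
    u t ≤ c := by
  rw [hu, ← one_mul c, ← hsum, Finset.sum_mul]
  exact Finset.sum_le_sum fun l hl => mul_le_mul_of_nonneg_left (hc l hl) (hw _)

lemma eq_of_forall_tau_le (hw : ∀ t, 0 ≤ w t) (hsum : ∑ l ∈ L, w (tau R l t) = 1)
    (hu : u t = ∑ l ∈ L, w (tau R l t) * u (tau R l t)) (hc : ∀ l ∈ L, u (tau R l t) ≤ c)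
    (ht : u t = c) {l : ℝ} (hl : l ∈ L) (hwl : w (tau R l t) ≠ 0) : u (tau R l t) = c := by
  have hzero : ∑ l ∈ L, w (tau R l t) * (c - u (tau R l t)) = 0 := by
    simp only [mul_sub, Finset.sum_sub_distrib, ← Finset.sum_mul, hsum, ← hu, ht, one_mul, sub_self]
  have hterm := (Finset.sum_eq_zero_iff_of_nonneg fun l hl =>
    mul_nonneg (hw _) (sub_nonneg.2 (hc l hl))).1 hzero l hl
  exact (sub_eq_zero.1 ((mul_eq_zero.1 hterm).resolve_left hwl)).symm

lemma le_apply_zero_of_mem_attractor (hR : 1 < R) (hL : 0 ∈ L) (hw : ∀ t, 0 ≤ w t)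
    (hsum : ∀ t, ∑ l ∈ L, w (tau R l t) = 1) (hcont : Continuous u)
    (hu : ∀ t, u t = ∑ l ∈ L, w (tau R l t) * u (tau R l t))
    (hne : ∀ t ∈ attractor R L, w (t / R) ≠ 0)
    (ht : t ∈ attractor R L) : u t ≤ u 0 := by
  have hR0 : R ≠ 0 := by positivity
  obtain ⟨s, hs, hmax⟩ := (isCompact_attractor hR L).exists_isMaxOn
    ⟨0, zero_mem_attractor R hL⟩ hcont.continuousOn
  have htau_zero (x : ℝ) : tau R 0 x = x / R := by rw [tau, add_zero, inv_mul_eq_div]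
  have horbit (n : ℕ) : s / R ^ n ∈ attractor R L ∧ u (s / R ^ n) = u s := by
    induction n with
    | zero => simpa using hs
    | succ n ih =>
      rw [pow_succ, ← div_div, ← htau_zero]
      refine ⟨tau_mem_attractor hR0 hL ih.1, eq_of_forall_tau_le hw (hsum _) (hu _)
        (fun l hl => hmax (tau_mem_attractor hR0 hl ih.1)) ih.2 hL ?_⟩
      rw [htau_zero]
      exact hne _ ih.1
  have hlim : Filter.Tendsto (fun n : ℕ => u (s / R ^ n)) Filter.atTop (𝓝 (u 0)) :=
    (hcont.tendsto 0).comp (tendsto_const_nhds.div_atTop (tendsto_pow_atTop_atTop_of_one_lt hR))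
  simp only [horbit] at hlim
  exact (hmax ht).trans_eq (tendsto_nhds_unique tendsto_const_nhds hlim)

lemma le_apply_zero (hR : 1 < R) (hL : 0 ∈ L) (hw : ∀ t, 0 ≤ w t)
    (hsum : ∀ t, ∑ l ∈ L, w (tau R l t) = 1) (hcont : Continuous u)
    (hu : ∀ t, u t = ∑ l ∈ L, w (tau R l t) * u (tau R l t))
    (hne : ∀ t ∈ attractor R L, w (t / R) ≠ 0) (t : ℝ) : u t ≤ u 0 := by
  have hX : (attractor R L).Nonempty := ⟨0, zero_mem_attractor R hL⟩
  refine le_of_forall_pos_le_add fun ε hε => ?_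
  obtain ⟨δ, hδ, hsub⟩ := (isCompact_attractor hR L).exists_thickening_subset_open
    (isOpen_lt hcont continuous_const) fun x hx =>
      (le_apply_zero_of_mem_attractor hR hL hw hsum hcont hu hne hx).trans_lt
        (lt_add_of_pos_right _ hε)
  have hgrow (n : ℕ) : ∀ x, Metric.infDist x (attractor R L) < R ^ n * δ → u x ≤ u 0 + ε := by
    induction n with
    | zero =>
      intro x hx
      rw [pow_zero, one_mul, ← Metric.mem_thickening_iff_infDist_lt hX] at hx
      exact (hsub hx).le
    | succ n ih =>
      intro x hx
      refine le_of_forall_tau_le hw (hsum x) (hu x) fun l hl => ih _ ?_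
      rw [pow_succ', mul_assoc] at hx
      exact (infDist_tau_le hR hl x).trans_lt ((inv_mul_lt_iff₀ (by positivity)).2 hx)
  obtain ⟨n, hn⟩ := (((tendsto_pow_atTop_atTop_of_one_lt hR).atTop_mul_const hδ).eventually_gt_atTop
    (Metric.infDist t (attractor R L))).exists
  exact hgrow n t hn

end MaximumPrinciple

section CuntzIsometries

variable {R : ℝ} {B L : Finset ℝ} {μ : Measure ℝ} {r : ℝ → ℝ}

lemma coeFn_cuntzOp (hr : MeasurePreserving r μ μ) (l : ℝ) (f : Lp ℂ 2 μ) :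
    cuntzOp hr l f =ᵐ[μ] fun x => expFun l x * f (r x) :=
  (memLp_cuntz hr l f).coeFn_toLp

lemma cuntzWord_cons (hr : MeasurePreserving r μ μ) (l : L) (w : List L) (f : Lp ℂ 2 μ) :
    cuntzWord hr (l :: w) f = cuntzOp hr l (cuntzWord hr w f) := rfl

lemma range_cuntzWord (hr : MeasurePreserving r μ μ) (f : Lp ℂ 2 μ) :
    (Set.range fun w : List L => cuntzWord hr w f) = wordOrbit (fun l : L => cuntzOp hr l) f := by
  rw [wordOrbit]
  congr 1
  funext w
  induction w with
  | nil => rfl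
  | cons l w ih => rw [cuntzWord_cons, ih, List.foldr_cons]

lemma coeFn_cuntzOp_expLp [IsFiniteMeasure μ] (hr : MeasurePreserving r μ μ) (l t : ℝ) :
    cuntzOp hr l (expLp μ t) =ᵐ[μ] fun x => expFun l x * expFun t (r x) := by
  filter_upwards [coeFn_cuntzOp hr l (expLp μ t),
    hr.quasiMeasurePreserving.ae (coeFn_expLp (μ := μ) t)] with x hx hexp
  rw [hx, hexp]

lemma cuntzOp_zero_const [IsFiniteMeasure μ] (hr : MeasurePreserving r μ μ) (hL : 0 ∈ L) :
    cuntzOp hr (⟨0, hL⟩ : L) (Lp.const 2 μ (1 : ℂ)) = Lp.const 2 μ 1 := by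
  rw [← expLp_zero]
  refine Lp.ext ?_
  filter_upwards [coeFn_cuntzOp_expLp hr 0 0, coeFn_expLp (μ := μ) 0] with x hx hexp
  rw [hx, hexp, expFun_zero_left, expFun_zero_left, one_mul]

/-- The linear span of the vectors `S_w 1`, where `w` runs through the words with digits in `L`. -/
noncomputable def wordSpan [IsFiniteMeasure μ] (L : Finset ℝ) (hr : MeasurePreserving r μ μ) :
    Submodule ℂ (Lp ℂ 2 μ) :=
  Submodule.span ℂ (wordOrbit (fun l : L => cuntzOp hr l) (Lp.const 2 μ 1))

variable [IsProbabilityMeasure μ]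

lemma orthogonalFamily_cuntzOp (hR : 1 < R) (hspec : IsSpectrum (B.image fun b => R⁻¹ * b) L)
    (hμ : IsInvariantMeasure R B μ) (hno : NoOverlap R B μ)
    (hr : MeasurePreserving (shiftMap R B) μ μ) :
    OrthogonalFamily ℂ (fun _ : L => Lp ℂ 2 μ) fun l => cuntzOp hr l := by
  intro l l' hne f g
  have hint : Integrable (fun x => ⟪f x, g x⟫_ℂ) μ := L2.integrable_inner f g
  have hinner : ⟪cuntzOp hr l f, cuntzOp hr l' g⟫_ℂ =
      ∫ x, expFun (l' - l) x * ⟪f (shiftMap R B x), g (shiftMap R B x)⟫_ℂ ∂μ := by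
    rw [L2.inner_def]
    refine integral_congr_ae ?_
    filter_upwards [coeFn_cuntzOp hr l f, coeFn_cuntzOp hr l' g] with x hf hg
    rw [hf, hg, sub_eq_add_neg, expFun_add_left, ← star_expFun]
    simp only [RCLike.inner_apply', map_mul, Complex.star_def]
    ring
  rw [hinner, hμ.integral_expFun_mul_comp_shiftMap hR hno _ hint,
    maskFun_sub_div_eq_zero (by positivity) hspec l'.2 l.2 (Subtype.coe_injective.ne hne.symm),
    zero_mul]

lemma expLp_eq_sum_cuntzOp (hR : 1 < R) (hspec : IsSpectrum (B.image fun b => R⁻¹ * b) L)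
    (hμ : IsInvariantMeasure R B μ) (hno : NoOverlap R B μ)
    (hr : MeasurePreserving (shiftMap R B) μ μ) (t : ℝ) :
    expLp μ t = ∑ l ∈ L, maskFun B ((t - l) / R) • cuntzOp hr l (expLp μ ((t - l) / R)) := by
  have hR0 : R ≠ 0 := by positivity
  have hpoint : ∀ᵐ x ∂μ, expFun t x =
      ∑ l ∈ L, maskFun B ((t - l) / R) * (expFun l x * expFun ((t - l) / R) (shiftMap R B x)) := by
    refine (hμ.ae_iff hR0).2 fun b hb => ?_
    filter_upwards [hμ.ae_shiftMap_tau hR hno hb] with y hy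
    have hterm (l : ℝ) : expFun l (tau R b y) * expFun ((t - l) / R) y =
        expFun l (R⁻¹ * b) * expFun t (R⁻¹ * y) := by
      rw [expFun_congr (by ring : (t - l) / R * y = (t - l) * (R⁻¹ * y)), tau, mul_add, add_comm,
        expFun_add_right, mul_assoc, ← expFun_add_left, add_sub_cancel]
    simp only [hy, hterm, ← mul_assoc, ← Finset.sum_mul]
    rw [sum_maskFun_mul_expFun hR0 hspec t hb, ← expFun_add_right, ← mul_add, add_comm, tau]
  have hS : ∀ᵐ x ∂μ, ∀ l ∈ L, cuntzOp hr l (expLp μ ((t - l) / R)) x =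
      expFun l x * expFun ((t - l) / R) (shiftMap R B x) :=
    (Filter.eventually_all_finset L).2 fun l _ => coeFn_cuntzOp_expLp hr l _
  have hsmul : ∀ᵐ x ∂μ, ∀ l ∈ L,
      (maskFun B ((t - l) / R) • cuntzOp hr l (expLp μ ((t - l) / R)) : Lp ℂ 2 μ) x =
        maskFun B ((t - l) / R) • cuntzOp hr l (expLp μ ((t - l) / R)) x :=
    (Filter.eventually_all_finset L).2 fun l _ => Lp.coeFn_smul _ _
  refine Lp.ext ?_
  filter_upwards [coeFn_expLp (μ := μ) t, hpoint, hS, hsmul, Lp.coeFn_finsetSum L fun l =>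
    maskFun B ((t - l) / R) • cuntzOp hr l (expLp μ ((t - l) / R))] with x hexp hx hSx hsmulx hsum
  rw [hexp, hx, hsum, Finset.sum_apply]
  exact Finset.sum_congr rfl fun l hl => by rw [hsmulx l hl, hSx l hl, smul_eq_mul]

lemma norm_starProjection_orthogonal_wordSpan_expLp_neg_sq (hR : 1 < R) (hL : 0 ∈ L)
    (hspec : IsSpectrum (B.image fun b => R⁻¹ * b) L) (hμ : IsInvariantMeasure R B μ)
    (hno : NoOverlap R B μ) (hr : MeasurePreserving (shiftMap R B) μ μ) (t : ℝ) :
    ‖(wordSpan L hr)ᗮ.starProjection (expLp μ (-t))‖ ^ 2 =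
      ∑ l ∈ L, ‖maskFun B (tau R l t)‖ ^ 2 *
        ‖(wordSpan L hr)ᗮ.starProjection (expLp μ (-tau R l t))‖ ^ 2 := by
  have hsplit : expLp μ (-t) = ∑ l : L, maskFun B (-tau R l t) •
      cuntzOp hr l (expLp μ (-tau R l t)) := by
    rw [Finset.sum_coe_sort L fun l => maskFun B (-tau R l t) •
      cuntzOp hr l (expLp μ (-tau R l t)), expLp_eq_sum_cuntzOp hR hspec hμ hno hr]
    refine Finset.sum_congr rfl fun l _ => ?_
    rw [show (-t - l) / R = -tau R l t by rw [tau]; ring]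
  have hnorm := norm_starProjection_orthogonal_wordOrbit_sum_sq
    (orthogonalFamily_cuntzOp hR hspec hμ hno hr) (cuntzOp_zero_const hr hL)
    Finset.univ (fun l => maskFun B (-tau R l t)) fun l => expLp μ (-tau R l t)
  rw [← hsplit] at hnorm
  simp only [norm_maskFun_neg] at hnorm
  exact hnorm.trans (Finset.sum_coe_sort L fun l => ‖maskFun B (tau R l t)‖ ^ 2 *
    ‖(wordSpan L hr)ᗮ.starProjection (expLp μ (-tau R l t))‖ ^ 2)

lemma expLp_mem_orthogonal_orthogonal_wordSpan (hR : 1 < R) (hL : 0 ∈ L)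
    (hspec : IsSpectrum (B.image fun b => R⁻¹ * b) L)
    (hmask : ∀ t ∈ attractor R L, maskFun B (t / R) ≠ 0) (hμ : IsInvariantMeasure R B μ)
    (hno : NoOverlap R B μ) (hr : MeasurePreserving (shiftMap R B) μ μ) (t : ℝ) :
    expLp μ t ∈ (wordSpan L hr)ᗮᗮ := by
  have hzero : (wordSpan L hr)ᗮ.starProjection (expLp μ 0) = 0 := by
    rw [Submodule.starProjection_apply_eq_zero_iff, expLp_zero]
    exact Submodule.le_orthogonal_orthogonal _ (Submodule.subset_span (self_mem_wordOrbit _ _))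
  have hcont : Continuous fun t => ‖(wordSpan L hr)ᗮ.starProjection (expLp μ (-t))‖ ^ 2 :=
    (((ContinuousLinearMap.continuous _).comp (continuous_expLp.comp continuous_neg)).norm).pow 2
  have hle := le_apply_zero hR hL (fun t => sq_nonneg ‖maskFun B t‖)
    (sum_norm_maskFun_tau_sq (by positivity) hspec hμ.nonempty_digits) hcont
    (norm_starProjection_orthogonal_wordSpan_expLp_neg_sq hR hL hspec hμ hno hr)
    (fun t ht => pow_ne_zero 2 (norm_ne_zero_iff.2 (hmask t ht))) (-t)
  rw [neg_neg, neg_zero, hzero, norm_zero, zero_pow two_ne_zero] at hle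
  rw [← Submodule.starProjection_apply_eq_zero_iff, ← norm_eq_zero]
  exact pow_eq_zero_iff two_ne_zero |>.1 (le_antisymm hle (sq_nonneg _))

lemma exists_hilbertBasis_cuntzWord (hR : 1 < R) (hL : 0 ∈ L)
    (hspec : IsSpectrum (B.image fun b => R⁻¹ * b) L)
    (hmask : ∀ t ∈ attractor R L, maskFun B (t / R) ≠ 0)
    (hμ : IsInvariantMeasure R B μ) (hno : NoOverlap R B μ)
    (hr : MeasurePreserving (shiftMap R B) μ μ) :
    ∃ e : HilbertBasis (Set.range fun w : List L => cuntzWord hr w (Lp.const 2 μ (1 : ℂ)))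
        ℂ (Lp ℂ 2 μ), ∀ v, e v = (v : Lp ℂ 2 μ) := by
  have htotal : (wordSpan L hr)ᗮ = ⊥ := (Submodule.eq_bot_iff _).2 fun f hf =>
    eq_zero_of_inner_expLp fun t => Submodule.inner_left_of_mem_orthogonal hf
      (expLp_mem_orthogonal_orthogonal_wordSpan hR hL hspec hmask hμ hno hr t)
  rw [range_cuntzWord]
  exact exists_hilbertBasis_wordOrbit
    (orthogonalFamily_cuntzOp hR hspec hμ hno hr) (cuntzOp_zero_const hr hL)
    (by simp [Lp.norm_const']) htotal

end CuntzIsometries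

section Words

variable {R : ℝ} {B : Finset ℝ} {n : ℕ}

lemma freq_succ (R : ℝ) (l : Fin (n + 1) → ℝ) :
    freq R l = l 0 + R * freq R fun k => l k.succ := by
  simp only [freq, Fin.sum_univ_succ, Finset.mul_sum, Fin.val_zero, pow_zero, one_mul, Fin.val_succ,
    pow_succ', mul_assoc]

lemma phase_succ (R : ℝ) (b l : Fin (n + 1) → ℝ) :
    phase R b l = phase R (fun k => b k.succ) (fun k => l k.succ) -
      b 0 * freq R fun k => l k.succ := by
  have hinner (k : Fin n) : ∑ j : Fin (n + 1) with j < k.succ,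
      R ^ ((k.succ : ℕ) - 1 - (j : ℕ)) * b j =
        R ^ (k : ℕ) * b 0 + ∑ j : Fin n with j < k, R ^ ((k : ℕ) - 1 - (j : ℕ)) * b j.succ := by
    rw [Finset.sum_filter, Finset.sum_filter, Fin.sum_univ_succ]
    congr 1
    refine Finset.sum_congr rfl fun j _ => ?_
    simp only [Fin.succ_lt_succ_iff, Fin.val_succ]
    rw [Nat.add_sub_cancel, Nat.sub_sub, add_comm 1]
  rw [phase, Fin.sum_univ_succ]
  simp only [hinner, Fin.not_lt_zero, Finset.filter_false, Finset.sum_empty, zero_mul, zero_add]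
  simp only [phase, freq, add_mul, Finset.sum_add_distrib, Finset.mul_sum]
  rw [neg_add, sub_eq_add_neg, add_comm]
  congr 2
  exact Finset.sum_congr rfl fun k _ => by ring

lemma phase_mem (m : ℕ) {G : AddSubgroup ℝ} {b l : Fin n → ℝ} (h : ∀ j k, b j * l k ∈ G) :
    phase m b l ∈ G := by
  refine G.neg_mem (G.sum_mem fun k _ => ?_)
  rw [Finset.sum_mul]
  refine G.sum_mem fun j _ => ?_
  rw [mul_assoc, ← Nat.cast_pow, ← nsmul_eq_mul]
  exact G.nsmul_mem (h j k) _

lemma mem_ifsCylinder_succ {b : Fin (n + 1) → B} {x : ℝ} :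
    x ∈ ifsCylinder R B b ↔ ∃ y ∈ ifsCylinder R B fun k => b k.succ, tau R (b 0) y = x := by
  simp only [ifsCylinder, List.ofFn_succ, Set.mem_image, exists_exists_and_eq_and]
  rfl

lemma mem_ifsCylinder_zero {b : Fin 0 → B} {x : ℝ} :
    x ∈ ifsCylinder R B b ↔ x ∈ attractor R B := by
  simp [ifsCylinder]

lemma ifsCylinder_subset_attractor (hR : R ≠ 0) (b : Fin n → B) :
    ifsCylinder R B b ⊆ attractor R B := by
  induction n with
  | zero => exact fun x => mem_ifsCylinder_zero.1
  | succ n ih =>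
    intro x hx
    obtain ⟨y, hy, rfl⟩ := mem_ifsCylinder_succ.1 hx
    exact tau_mem_attractor hR (b 0).2 (ih _ hy)

lemma exists_mem_ifsCylinder (hR : R ≠ 0) (n : ℕ) {x : ℝ} (hx : x ∈ attractor R B) :
    ∃ b : Fin n → B, x ∈ ifsCylinder R B b := by
  induction n generalizing x with
  | zero => exact ⟨Fin.elim0, mem_ifsCylinder_zero.2 hx⟩
  | succ n ih =>
    obtain ⟨d, hd, y, hy, hyx⟩ := (mem_attractor_iff hR).1 hx
    obtain ⟨b, hb⟩ := ih hy
    exact ⟨Fin.cons ⟨d, hd⟩ b, mem_ifsCylinder_succ.2 ⟨y, by simpa using hb, by simpa using hyx⟩⟩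

lemma expFun_phase_mul_expFun_freq_tau (hR : R ≠ 0) (b l : Fin (n + 1) → ℝ) (y : ℝ) :
    expFun (phase R b l) 1 * expFun (freq R l) (tau R (b 0) y) =
      expFun (l 0) (tau R (b 0) y) *
        (expFun (phase R (fun k => b k.succ) fun k => l k.succ) 1 *
          expFun (freq R fun k => l k.succ) y) := by
  set s := freq R fun k => l k.succ
  have hfreq : expFun (R * s) (tau R (b 0) y) = expFun (b 0 * s) 1 * expFun s y := by
    rw [expFun_congr (by rw [tau]; field_simp : R * s * tau R (b 0) y = s * (y + b 0)),
      expFun_add_right, mul_comm, expFun_congr (by ring : s * b 0 = b 0 * s * 1)]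
  have hcancel : expFun (-(b 0 * s)) 1 * expFun (b 0 * s) 1 = 1 := by
    rw [← expFun_add_left, neg_add_cancel, expFun_zero_left]
  rw [phase_succ, freq_succ, sub_eq_add_neg, expFun_add_left, expFun_add_left, hfreq]
  linear_combination (expFun (phase R (fun k => b k.succ) fun k => l k.succ) 1 *
    expFun (l 0) (tau R (b 0) y) * expFun s y) * hcancel

lemma ae_cuntzWord_eq {μ : Measure ℝ} [IsFiniteMeasure μ] (hR : R ≠ 0) (hno : NoOverlap R B μ)
    (hr : MeasurePreserving (shiftMap R B) μ μ) {L : Finset ℝ} (l : Fin n → L) :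
    ∀ᵐ x ∂μ, ∀ b : Fin n → B, x ∈ ifsCylinder R B b →
      cuntzWord hr (List.ofFn l) (Lp.const 2 μ (1 : ℂ)) x =
        expFun (phase R (fun k => (b k : ℝ)) fun k => (l k : ℝ)) 1 *
          expFun (freq R fun k => (l k : ℝ)) x := by
  induction n with
  | zero =>
    filter_upwards [Lp.coeFn_const (p := 2) (μ := μ) (1 : ℂ)] with x hx b _
    rw [List.ofFn_zero]
    exact hx.trans (by simp [phase, freq])
  | succ n ih =>
    rw [List.ofFn_succ, cuntzWord_cons]
    filter_upwards [hr.quasiMeasurePreserving.ae (ih fun k => l k.succ), hno.ae_shiftMap_eq,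
      coeFn_cuntzOp hr (l 0) (cuntzWord hr (List.ofFn fun k => l k.succ) (Lp.const 2 μ (1 : ℂ)))]
      with x htail hshift hhead b hb
    obtain ⟨y, hy, rfl⟩ := mem_ifsCylinder_succ.1 hb
    have hry : shiftMap R B (tau R (b 0) y) = y := by
      rw [hshift (b 0) (b 0).2 ⟨y, ifsCylinder_subset_attractor hR _ hy, rfl⟩, tau,
        mul_inv_cancel_left₀ hR, add_sub_cancel_right]
    rw [hry] at htail hhead
    rw [hhead, htail _ hy]
    exact (expFun_phase_mul_expFun_freq_tau hR (fun k => b k) (fun k => l k) y).symm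

end Words

section Cantor

lemma mem_cantorB {b : ℝ} : b ∈ cantorB ↔ b = 0 ∨ b = 2 := by simp [cantorB]

lemma mem_cantorL {l : ℝ} : l ∈ cantorL ↔ l = 0 ∨ l = 3 / 4 := by simp [cantorL]

lemma nonempty_cantorB : cantorB.Nonempty := ⟨0, mem_cantorB.2 (.inl rfl)⟩

lemma zero_mem_cantorL : 0 ∈ cantorL := mem_cantorL.2 (.inl rfl)

lemma natCast_mem_cantorB {d : Fin 3} (hd : d ≠ 1) : ((d : ℕ) : ℝ) ∈ cantorB := by
  fin_cases d <;> simp_all [mem_cantorB]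

lemma attractor_cantorB : attractor 3 cantorB = cantorSet := by
  rw [cantorSet_eq_zero_two_ofDigits]
  ext x
  constructor
  · rintro ⟨b, hb, hx⟩
    refine ⟨fun k => if b k = 0 then 0 else 2, fun k => by beta_reduce; split_ifs <;> decide, ?_⟩
    rw [Real.ofDigits, ← hx.tsum_eq]
    refine tsum_congr fun k => ?_
    rcases mem_cantorB.1 (hb k) with h | h <;> simp [Real.ofDigitsTerm, h, mul_comm]
  · rintro ⟨a, ha, rfl⟩
    refine ⟨fun k => (a k : ℕ), fun k => natCast_mem_cantorB (ha k), ?_⟩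
    convert! (Real.summable_ofDigitsTerm (digits := a)).hasSum using 2 with k
    simp [Real.ofDigitsTerm, mul_comm]

lemma isSpectrum_cantorL : IsSpectrum (cantorB.image fun b => (3 : ℝ)⁻¹ * b) cantorL := by
  refine (isSpectrum_iff (nonempty_cantorB.image _)).2 ⟨?_, ?_⟩
  · rw [card_image_inv_mul three_ne_zero, cantorL, cantorB, Finset.card_pair (by norm_num),
      Finset.card_pair (by norm_num)]
  · intro a ha a' ha' hne
    obtain ⟨b, hb, rfl⟩ := Finset.mem_image.1 ha
    obtain ⟨b', hb', rfl⟩ := Finset.mem_image.1 ha'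
    have hhalf : |(3 / 4 : ℝ) * (3⁻¹ * b - 3⁻¹ * b')| = 1 / 2 := by
      rcases mem_cantorB.1 hb with rfl | rfl <;> rcases mem_cantorB.1 hb' with rfl | rfl <;>
        first | exact absurd rfl hne | norm_num [abs_of_nonneg, abs_of_nonpos]
    rw [cantorL, Finset.sum_pair (by norm_num), expFun_zero_left, expFun_eq_neg_one hhalf,
      add_neg_cancel]

lemma noOverlap_cantorB (μ : Measure ℝ) : NoOverlap 3 cantorB μ := by
  have hsub : attractor 3 cantorB ⊆ Set.Icc 0 1 := by
    rw [attractor_cantorB]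
    exact cantorSet_subset_unitInterval
  intro b hb b' hb' hne
  have hdisj : tau 3 b '' attractor 3 cantorB ∩ tau 3 b' '' attractor 3 cantorB = ∅ := by
    refine Set.eq_empty_of_forall_notMem ?_
    rintro _ ⟨⟨y, hy, rfl⟩, ⟨y', hy', heq⟩⟩
    obtain ⟨hy0, hy1⟩ := hsub hy
    obtain ⟨hy0', hy1'⟩ := hsub hy'
    rw [tau, tau] at heq
    rcases mem_cantorB.1 hb with rfl | rfl <;> rcases mem_cantorB.1 hb' with rfl | rfl <;>
      first | exact hne rfl | linarith
  rw [hdisj, measure_empty]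

lemma maskFun_cantorB_div_ne_zero (t : ℝ) (ht : t ∈ attractor 3 cantorL) :
    maskFun cantorB (t / 3) ≠ 0 := by
  have hL : ∀ l ∈ cantorL, l ∈ Set.Icc (0 : ℝ) (3 / 4) := by
    intro l hl
    rcases mem_cantorL.1 hl with rfl | rfl <;> norm_num
  obtain ⟨ht0, ht1⟩ := attractor_subset_Icc (by norm_num) hL ht
  have hmask : maskFun cantorB (t / 3) = 2⁻¹ * (1 + expFun 2 (t / 3)) := by
    simp [maskFun, cantorB]
  have hcos : 0 ≤ (expFun 2 (t / 3)).re := by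
    rw [expFun_re]
    refine Real.cos_nonneg_of_mem_Icc ⟨?_, ?_⟩ <;> nlinarith [Real.pi_pos]
  intro hzero
  have hexp : expFun 2 (t / 3) = -1 := by
    rw [hmask] at hzero
    linear_combination 2 * hzero
  rw [hexp] at hcos
  norm_num at hcos

lemma mul_mem_zmultiples_half {b l : ℝ} (hb : b ∈ cantorB) (hl : l ∈ cantorL) :
    b * l ∈ AddSubgroup.zmultiples (1 / 2 : ℝ) := by
  rcases mem_cantorB.1 hb with rfl | rfl <;> rcases mem_cantorL.1 hl with rfl | rfl
  · exact ⟨0, by norm_num⟩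
  · exact ⟨0, by norm_num⟩
  · exact ⟨0, by norm_num⟩
  · exact ⟨3, by norm_num⟩

lemma expFun_phase_eq_one_or_neg_one {n : ℕ} (b : Fin n → cantorB) (l : Fin n → cantorL) :
    expFun (phase 3 (fun k => (b k : ℝ)) fun k => (l k : ℝ)) 1 ∈ ({1, -1} : Set ℂ) :=
  expFun_eq_one_or_neg_one (phase_mem 3 fun j k => mul_mem_zmultiples_half (b j).2 (l k).2)

end Cantor

end PiecewiseExp

theorem mainTheorem7 :
    attractor 3 cantorB = cantorSet ∧
    IsSpectrum (cantorB.image (fun b => (3 : ℝ)⁻¹ * b)) cantorL ∧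
    (∀ c : ℝ, IsExtremeCyclePoint 3 cantorB cantorL c ↔ c = 0) ∧
    (∀ C : Set ℝ, IsExtremeCycle 3 cantorB cantorL C ↔ C = {0}) ∧
    ∀ (μ : Measure ℝ) [IsProbabilityMeasure μ],
      IsInvariantMeasure 3 cantorB μ →
      NoOverlap 3 cantorB μ ∧
      ∃ hr : MeasurePreserving (shiftMap 3 cantorB) μ μ,
        (∃ e : HilbertBasis
              (Set.range fun w : List cantorL =>
                cuntzWord hr w (Lp.const 2 μ (1 : ℂ)))
              ℂ (Lp ℂ 2 μ),
            ∀ v, e v = (v : Lp ℂ 2 μ)) ∧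
        ∀ (n : ℕ) (l : Fin n → cantorL),
          (∀ b : Fin n → cantorB,
            expFun (phase 3 (fun k => (b k : ℝ)) (fun k => (l k : ℝ))) 1
              ∈ ({1, -1} : Set ℂ)) ∧
          ∀ᵐ x ∂μ,
            (∃ b : Fin n → cantorB, x ∈ ifsCylinder 3 cantorB b) ∧
            ∀ b : Fin n → cantorB, x ∈ ifsCylinder 3 cantorB b →
              cuntzWord hr (List.ofFn l) (Lp.const 2 μ (1 : ℂ)) x =
                expFun
                    (phase 3 (fun k => (b k : ℝ)) (fun k => (l k : ℝ))) 1 *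
                  expFun (freq 3 (fun k => (l k : ℝ))) x := by
  have hR : (1 : ℝ) < 3 := by norm_num
  have hR0 : (3 : ℝ) ≠ 0 := three_ne_zero
  have hB := nonempty_cantorB
  have hL := zero_mem_cantorL
  have hspec := isSpectrum_cantorL
  have hmask := maskFun_cantorB_div_ne_zero
  refine ⟨attractor_cantorB, hspec, fun c => isExtremeCyclePoint_iff hR hspec hB hL hmask,
    fun C => isExtremeCycle_iff hR hspec hB hL hmask, fun μ _ hμ => ?_⟩
  have hno := noOverlap_cantorB μ
  have hr := hμ.measurePreserving_shiftMap hR hno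
  refine ⟨hno, hr, exists_hilbertBasis_cuntzWord hR hL hspec hmask hμ hno hr, fun n l =>
    ⟨fun b => expFun_phase_eq_one_or_neg_one b l, ?_⟩⟩
  filter_upwards [hμ.ae_mem_attractor hR, ae_cuntzWord_eq hR0 hno hr l] with x hx hword
  exact ⟨exists_mem_ifsCylinder hR0 n hx, hword⟩
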